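/- Let $\mathbb K\in\{\mathbb R,\mathbb C\}$. If $\mathbb K=\mathbb R$, let $r\in\{1,2,3,\ldots\}\cup\{\infty,\omega\}$; if $\mathbb K=\mathbb C$, let $r=\omega$. Here $C^r_{\mathbb R}$ for $r\le\infty$ means $C^r$ in the Michal--Bastiani sense, $C^\omega_{\mathbb R}$ means real analytic, and $C^\omega_{\mathbb C}$ means complex analytic; manifolds and locally convex spaces are Hausdorff. A $C^r_{\mathbb K}$-map $h\colon M\to N$ between $C^r_{\mathbb K}$-manifolds modelled on locally convex spaces $E$ and $F$ is a $C^r_{\mathbb K}$-submersion if for each $x\in M$ there are charts $\phi\colon U_\phi\to V_\phi\subseteq E$ of $M$ with $x\in U_\phi$ and $\psi\colon U_\psi\to V_\psi\subseteq F$ of $N$ with $h(U_\phi)\subseteq U_\psi$ such that $\psi\circ h\circ\phi^{-1}=\pi|_{V_\phi}$ for a continuous linear map $\pi\colon E\to F$ which has a continuous linear right inverse. A subset $S\subseteq M$ is a (not necessarily pure) split $C^r_{\mathbb K}$-submanifold of $M$ if its connected components are open in $S$ and for each component $C$ there is a closed vector subspace $Y_C\subseteq E$, complemented in $E$ as a topological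 vector space, such that each $x\in C$ lies in the domain of a chart $\phi\colon U_\phi\to V_\phi$ of $M$ with $\phi(U_\phi\cap C)=V_\phi\cap Y_C$; then each $C$ is a $C^r_{\mathbb K}$-manifold modelled on $Y_C$, with the restrictions $\phi|_{U_\phi\cap C}$ as charts, and a map on $S$ is a $C^r_{\mathbb K}$-submersion if its restriction to each component is one. Theorem B. Let $M_1$, $M_2$ and $N$ be $C^r_{\mathbb K}$-manifolds modelled on locally convex topological $\mathbb K$-vector spaces, and let $f\colon M_1\to N$ and $g\colon M_2\to N$ be $C^r_{\mathbb K}$-maps. If $f$ (resp., $g$) is a $C^r_{\mathbb K}$-submersion, then the fibre product $$S:=M_1\times_{f,g}M_2:=\{(x,y)\in M_1\times M_2\colon f(x)=g(y)\}$$ is a (not necessarily pure) split $C^r_{\mathbb K}$-submanifold of $M_1\times M_2$, and the projection $\operatorname{pr}_2\colon M_1\times M_2\to M_2$ restricts to a $C^r_{\mathbb K}$-submersion $\operatorname{pr}_2|_S\colon S\to M_2$ (resp., $\operatorname{pr}_1\colon M_1\times M_2\to M_1$ restricts to a $C^r_{\mathbb K}$-submersion $\operatorname{pr}_1|_S\colon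 S\to M_1$). -/

import Mathlib

open Set Topology

namespace LCManifold

universe u v

/-! ### Differential calculus in locally convex spaces -/

section Calculus

/-- `f` is `C^k` over `ℝ` on the open set `U` in the sense of Michal and Bastiani, `k` finite:
`f` is `C^0` if it is continuous; `f` is `C^(k+1)` if it is continuous, all directional derivatives
`df (x, y) = lim_{t → 0} t⁻¹ (f (x + t y) - f x)`, `x ∈ U`, `y ∈ E`, exist, and
`df : U × E → F` is `C^k`. -/
def IsCk {F : Type v} [AddCommGroup F] [Module ℝ F] [TopologicalSpace F] :
    ℕ → ∀ {E : Type u} [AddCommGroup E] [Module ℝ E] [TopologicalSpace E],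
      Set E → (E → F) → Prop
  | 0, _, _, _, _, U, f => ContinuousOn f U
  | k + 1, E, _, _, _, U, f => ContinuousOn f U ∧ ∃ df : E × E → F,
      (∀ x ∈ U, ∀ y : E,
        Filter.Tendsto (fun t : ℝ => t⁻¹ • (f (x + t • y) - f x)) (𝓝[≠] 0) (𝓝 (df (x, y)))) ∧
      IsCk k (U ×ˢ (univ : Set E)) df

/-- `f` is complex analytic on the open set `U`: it is continuous and locally given by a pointwise
convergent series of continuous homogeneous polynomials `y ↦ β n (y, …, y)`. -/
def IsComplexAnalytic {E : Type u} {F : Type v} [AddCommGroup E] [Module ℂ E] [TopologicalSpace E]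
    [AddCommGroup F] [Module ℂ F] [TopologicalSpace F] (U : Set E) (f : E → F) : Prop :=
  ContinuousOn f U ∧ ∀ x ∈ U, ∃ V ∈ 𝓝 (0 : E),
    ∃ β : ∀ n : ℕ, ContinuousMultilinearMap ℂ (fun _ : Fin n => E) F,
      ∀ y ∈ V, x + y ∈ U ∧ HasSum (fun n => β n (fun _ => y)) (f (x + y))

/-- The complexification `E ⊕ iE` of a real topological vector space; `(x, y)` stands for
`x + i y`, and the topology is the product topology. -/
def Complexification (E : Type u) : Type u := E × E

namespace Complexification

variable (E : Type u) [AddCommGroup E]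

instance [TopologicalSpace E] : TopologicalSpace (Complexification E) :=
  inferInstanceAs (TopologicalSpace (E × E))

instance : AddCommGroup (Complexification E) := inferInstanceAs (AddCommGroup (E × E))

variable [Module ℝ E]

instance : SMul ℂ (Complexification E) where
  smul z p := (z.re • p.1 - z.im • p.2, z.re • p.2 + z.im • p.1)

theorem smul_def (z : ℂ) (p : Complexification E) :
    z • p = (z.re • p.1 - z.im • p.2, z.re • p.2 + z.im • p.1) := rfl

instance : Module ℂ (Complexification E) where
  one_smul p := by
    rw [smul_def]; refine Prod.ext ?_ ?_ <;> simp
  mul_smul z w p := by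
    simp only [smul_def]
    refine Prod.ext ?_ ?_
    · change (z * w).re • p.1 - (z * w).im • p.2
        = z.re • (w.re • p.1 - w.im • p.2) - z.im • (w.re • p.2 + w.im • p.1)
      simp only [Complex.mul_re, Complex.mul_im]; module
    · change (z * w).re • p.2 + (z * w).im • p.1
        = z.re • (w.re • p.2 + w.im • p.1) + z.im • (w.re • p.1 - w.im • p.2)
      simp only [Complex.mul_re, Complex.mul_im]; module
  smul_zero z := by
    rw [smul_def]; refine Prod.ext ?_ ?_
    · change z.re • (0 : E) - z.im • (0 : E) = 0; simp
    · change z.re • (0 : E) + z.im • (0 : E) = 0; simp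
  smul_add z p q := by
    simp only [smul_def]
    refine Prod.ext ?_ ?_
    · change z.re • (p.1 + q.1) - z.im • (p.2 + q.2)
        = (z.re • p.1 - z.im • p.2) + (z.re • q.1 - z.im • q.2)
      module
    · change z.re • (p.2 + q.2) + z.im • (p.1 + q.1)
        = (z.re • p.2 + z.im • p.1) + (z.re • q.2 + z.im • q.1)
      module
  add_smul z w p := by
    simp only [smul_def]
    refine Prod.ext ?_ ?_
    · change (z + w).re • p.1 - (z + w).im • p.2
        = (z.re • p.1 - z.im • p.2) + (w.re • p.1 - w.im • p.2)
      simp only [Complex.add_re, Complex.add_im]; module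
    · change (z + w).re • p.2 + (z + w).im • p.1
        = (z.re • p.2 + z.im • p.1) + (w.re • p.2 + w.im • p.1)
      simp only [Complex.add_re, Complex.add_im]; module
  zero_smul p := by
    rw [smul_def]; refine Prod.ext ?_ ?_
    · change (0 : ℂ).re • p.1 - (0 : ℂ).im • p.2 = 0; simp
    · change (0 : ℂ).re • p.2 + (0 : ℂ).im • p.1 = 0; simp

variable {E}

/-- The inclusion `E → E ⊕ iE`, `x ↦ x + i 0`. -/
def ofReal (x : E) : Complexification E := (x, 0)

end Complexification

/-- `f` is real analytic on the open set `U`: it extends to a complex analytic map from an open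
neighbourhood of `U` in the complexification of `E` to the complexification of `F`. -/
def IsRealAnalytic {E : Type u} {F : Type v} [AddCommGroup E] [Module ℝ E] [TopologicalSpace E]
    [AddCommGroup F] [Module ℝ F] [TopologicalSpace F] (U : Set E) (f : E → F) : Prop :=
  ∃ (W : Set (Complexification E)) (g : Complexification E → Complexification F),
    IsOpen W ∧ IsComplexAnalytic W g ∧
    ∀ x ∈ U, Complexification.ofReal x ∈ W ∧
      g (Complexification.ofReal x) = Complexification.ofReal (f x)

/-- The admissible pairs of a ground field `𝕂` and an order of differentiability `r`:
`𝕂 = ℝ` with `r ∈ {1, 2, 3, …} ∪ {∞, ω}`, and `𝕂 = ℂ` with `r = ω`. -/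
inductive Regularity : (𝕜 : Type) → [RCLike 𝕜] → Type
  | finite (k : ℕ+) : Regularity ℝ
  | smooth : Regularity ℝ
  | realAnalytic : Regularity ℝ
  | complexAnalytic : Regularity ℂ

/-- `f` is a `C^r_𝕂`-map on the open set `U`. -/
def IsCr : ∀ {𝕜 : Type} [RCLike 𝕜] (_ : Regularity 𝕜) {E : Type u} {F : Type v}
    [AddCommGroup E] [Module 𝕜 E] [TopologicalSpace E]
    [AddCommGroup F] [Module 𝕜 F] [TopologicalSpace F], Set E → (E → F) → Prop
  | _, _, .finite k, _, _, _, _, _, _, _, _, U, f => IsCk (k : ℕ) U f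
  | _, _, .smooth, _, _, _, _, _, _, _, _, U, f => ∀ k : ℕ, IsCk k U f
  | _, _, .realAnalytic, _, _, _, _, _, _, _, _, U, f => IsRealAnalytic U f
  | _, _, .complexAnalytic, _, _, _, _, _, _, _, _, U, f => IsComplexAnalytic U f

end Calculus

/-! ### Manifolds modelled on locally convex spaces -/

section Manifolds

variable {𝕜 : Type} [RCLike 𝕜] (r : Regularity 𝕜)
  (E : Type*) [AddCommGroup E] [Module 𝕜 E] [TopologicalSpace E]
  (F : Type*) [AddCommGroup F] [Module 𝕜 F] [TopologicalSpace F]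
  (M : Type*) [TopologicalSpace M] [ChartedSpace E M]
  {N : Type*} [TopologicalSpace N] [ChartedSpace F N]

/-- The changes of charts of the given atlas of `M` are `C^r_𝕂`. -/
def IsCrManifold : Prop :=
  ∀ e ∈ atlas E M, ∀ e' ∈ atlas E M, IsCr r (e.symm.trans e').source (e' ∘ e.symm)

/-- The charts of the `C^r_𝕂`-manifold `M`: the maximal `C^r_𝕂`-atlas containing
the given atlas. -/
def maxAtlas : Set (OpenPartialHomeomorph M E) :=
  {e | ∀ e' ∈ atlas E M, IsCr r (e.symm.trans e').source (e' ∘ e.symm) ∧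
    IsCr r (e'.symm.trans e).source (e ∘ e'.symm)}

variable {M}

/-- `f : M → N` is a `C^r_𝕂`-map between `C^r_𝕂`-manifolds modelled on `E` and `F`. -/
def IsCrMap (f : M → N) : Prop :=
  Continuous f ∧ ∀ φ ∈ maxAtlas r E M, ∀ ψ ∈ maxAtlas r F N,
    IsCr r (φ.target ∩ φ.symm ⁻¹' (f ⁻¹' ψ.source)) (ψ ∘ f ∘ φ.symm)

/-- `f : M → N` is a `C^r_𝕂`-submersion: a `C^r_𝕂`-map which in suitable charts around any point
is the restriction of a continuous linear map `π : E → F` with a continuous linear right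
inverse `σ`. -/
def IsSubmersion (f : M → N) : Prop :=
  IsCrMap r E F f ∧ ∀ x : M, ∃ φ ∈ maxAtlas r E M, ∃ ψ ∈ maxAtlas r F N,
    x ∈ φ.source ∧ f x ∈ ψ.source ∧ MapsTo f φ.source ψ.source ∧
    ∃ (π : E →L[𝕜] F) (σ : F →L[𝕜] E), π.comp σ = ContinuousLinearMap.id 𝕜 F ∧
      ∀ v ∈ φ.target, ψ (f (φ.symm v)) = π v

end Manifolds

/-- The product of a manifold modelled on `E₁` and one modelled on `E₂`, modelled on `E₁ × E₂`,
with the products of charts as charts. -/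
instance prodChartedSpace (E₁ E₂ M₁ M₂ : Type*) [TopologicalSpace E₁] [TopologicalSpace E₂]
    [TopologicalSpace M₁] [TopologicalSpace M₂] [ChartedSpace E₁ M₁] [ChartedSpace E₂ M₂] :
    ChartedSpace (E₁ × E₂) (M₁ × M₂) :=
  inferInstanceAs (ChartedSpace (ModelProd E₁ E₂) (M₁ × M₂))

/-! ### Submanifolds -/

section Submanifolds

variable {𝕜 : Type} [RCLike 𝕜] (r : Regularity 𝕜)
  {E : Type*} [AddCommGroup E] [Module 𝕜 E] [TopologicalSpace E]
  {M : Type*} [TopologicalSpace M]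

/-- The chart `φ` of `M` takes `S` to the vector subspace `Y` of the modelling space:
`φ (U_φ ∩ S) = V_φ ∩ Y`. -/
def IsAdapted (S : Set M) (Y : Submodule 𝕜 E) (φ : OpenPartialHomeomorph M E) : Prop :=
  φ '' (φ.source ∩ S) = φ.target ∩ (Y : Set E)

theorem IsAdapted.mem_iff {S : Set M} {Y : Submodule 𝕜 E} {φ : OpenPartialHomeomorph M E}
    (h : IsAdapted S Y φ) {x : M} (hx : x ∈ φ.source) : φ x ∈ Y ↔ x ∈ S := by
  constructor
  · intro hY
    have : φ x ∈ φ '' (φ.source ∩ S) := by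
      rw [show φ '' (φ.source ∩ S) = φ.target ∩ (Y : Set E) from h]
      exact ⟨φ.map_source hx, hY⟩
    obtain ⟨y, ⟨hy, hyS⟩, hxy⟩ := this
    rwa [← φ.injOn hy hx hxy]
  · intro hS
    have : φ x ∈ φ.target ∩ (Y : Set E) := by
      rw [← show φ '' (φ.source ∩ S) = φ.target ∩ (Y : Set E) from h]
      exact ⟨x, ⟨hx, hS⟩, rfl⟩
    exact this.2

theorem IsAdapted.symm_mem_iff {S : Set M} {Y : Submodule 𝕜 E} {φ : OpenPartialHomeomorph M E}
    (h : IsAdapted S Y φ) {v : E} (hv : v ∈ φ.target) : φ.symm v ∈ S ↔ v ∈ Y := by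
  rw [← h.mem_iff (φ.map_target hv), φ.right_inv hv]

open Classical in
/-- The chart `φ|_{U_φ ∩ S} : U_φ ∩ S → V_φ ∩ Y` of `S` obtained from a chart `φ` of `M` with
`φ (U_φ ∩ S) = V_φ ∩ Y`. (The values of the underlying total functions outside of these sets are
irrelevant; the point `c₀` only serves as such a value.) -/
noncomputable def IsAdapted.chart {S : Set M} {Y : Submodule 𝕜 E} {φ : OpenPartialHomeomorph M E}
    (h : IsAdapted S Y φ) (c₀ : S) : OpenPartialHomeomorph S Y where
  toFun c := if hc : φ c ∈ Y then ⟨φ c, hc⟩ else 0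
  invFun v := if hv : φ.symm v ∈ S then ⟨φ.symm v, hv⟩ else c₀
  source := Subtype.val ⁻¹' φ.source
  target := Subtype.val ⁻¹' φ.target
  map_source' c hc := by
    have hY : φ c ∈ Y := (h.mem_iff hc).2 c.2
    simpa [hY] using φ.map_source hc
  map_target' v hv := by
    have hS : φ.symm v ∈ S := (h.symm_mem_iff hv).2 v.2
    simpa [hS] using φ.map_target hv
  left_inv' c hc := by
    have hY : φ c ∈ Y := (h.mem_iff hc).2 c.2
    have hl : φ.symm (φ c) = c := φ.left_inv hc
    simp [hY, hl]
  right_inv' v hv := by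
    have hS : φ.symm v ∈ S := (h.symm_mem_iff hv).2 v.2
    have hl : φ (φ.symm v) = v := φ.right_inv hv
    simp [hS, hl]
  open_source := φ.open_source.preimage continuous_subtype_val
  open_target := φ.open_target.preimage continuous_subtype_val
  continuousOn_toFun := by
    rw [Topology.IsInducing.subtypeVal.continuousOn_iff]
    refine (φ.continuousOn.comp continuous_subtype_val.continuousOn fun c hc => hc).congr ?_
    intro c hc
    have hY : φ c ∈ Y := (h.mem_iff hc).2 c.2
    simp [hY]
  continuousOn_invFun := by
    rw [Topology.IsInducing.subtypeVal.continuousOn_iff]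
    refine (φ.symm.continuousOn.comp continuous_subtype_val.continuousOn fun v hv => hv).congr ?_
    intro v hv
    have hS : φ.symm v ∈ S := (h.symm_mem_iff hv).2 v.2
    simp [hS]

variable [ChartedSpace E M]

/-- `S ⊆ M` is a `C^r_𝕂`-submanifold of `M` modelled on the closed vector subspace `Y` of the
modelling space `E` of `M`. -/
structure IsSubmanifold (S : Set M) (Y : Submodule 𝕜 E) : Prop where
  isClosed : IsClosed (Y : Set E)
  exists_chart : ∀ x ∈ S, ∃ φ ∈ maxAtlas r E M, x ∈ φ.source ∧ IsAdapted S Y φ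

/-- `S ⊆ M` is a split `C^r_𝕂`-submanifold of `M` modelled on `Y`, i.e. the vector subspace `Y`
is, moreover, complemented in `E` as a topological vector space. -/
structure IsSplitSubmanifold (S : Set M) (Y : Submodule 𝕜 E) : Prop
    extends IsSubmanifold r S Y where
  complemented : ∃ Z : Submodule 𝕜 E, Submodule.IsTopCompl Y Z

variable {r}

/-- The atlas of a submanifold `S` modelled on `Y`: the maps `φ|_{U_φ ∩ S}` for all charts `φ`
of `M` with `φ (U_φ ∩ S) = V_φ ∩ Y`. -/
@[reducible] noncomputable def IsSubmanifold.chartedSpace {S : Set M} {Y : Submodule 𝕜 E}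
    (h : IsSubmanifold r S Y) : ChartedSpace Y S where
  atlas := {θ | ∃ φ ∈ maxAtlas r E M, ∃ (hφ : IsAdapted S Y φ) (c₀ : S), θ = hφ.chart c₀}
  chartAt c := (h.exists_chart c c.2).choose_spec.2.2.chart c
  mem_chart_source c := (h.exists_chart c c.2).choose_spec.2.1
  chart_mem_atlas c :=
    ⟨_, (h.exists_chart c c.2).choose_spec.1, (h.exists_chart c c.2).choose_spec.2.2, c, rfl⟩

variable (r)

/-- The connected components of the subset `S`, in the induced topology, as subsets of `M`. -/
def components (S : Set M) : Set (Set M) :=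
  {C | ∃ x ∈ S, C = connectedComponentIn S x}

variable (E) in
/-- `S ⊆ M` is a (not necessarily pure) split `C^r_𝕂`-submanifold of `M`: its connected components
are open in `S`, and each component `C` is a split `C^r_𝕂`-submanifold of `M` modelled on some
vector subspace of `E` (which may depend on `C`). -/
def IsSplitSubmanifoldNotPure (S : Set M) : Prop :=
  ∀ C ∈ components S, IsOpen (Subtype.val ⁻¹' C : Set S) ∧
    ∃ Y : Submodule 𝕜 E, IsSplitSubmanifold r C Y

variable {N : Type*} [TopologicalSpace N] (F : Type*) [AddCommGroup F] [Module 𝕜 F]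
  [TopologicalSpace F] [ChartedSpace F N]

variable (E) in
/-- The map `p : M → N` restricts to a `C^r_𝕂`-submersion on the (not necessarily pure) split
`C^r_𝕂`-submanifold `S` of `M`: each component `C` of `S`, with the submanifold structure, modelled
on any `Y` on which it can be modelled, is a `C^r_𝕂`-manifold, on which `p` is
a `C^r_𝕂`-submersion. -/
def RestrictsToSubmersion (S : Set M) (p : M → N) : Prop :=
  ∀ C ∈ components S, ∀ (Y : Submodule 𝕜 E) (h : IsSplitSubmanifold r C Y),
    letI : ChartedSpace Y C := h.toIsSubmanifold.chartedSpace
    IsCrManifold r Y C ∧ IsSubmersion r Y F (fun c : C => p c)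

end Submanifolds

/-- The fibre product `{(x, y) ∈ M₁ × M₂ : f x = g y}`. -/
def fibreProduct {M₁ M₂ N : Type*} (f : M₁ → N) (g : M₂ → N) : Set (M₁ × M₂) :=
  {q | f q.1 = g q.2}

end LCManifold

open LCManifold

set_option linter.unusedSectionVars false

namespace LCManifold

/-! ### Power series in one complex variable -/

section OneVariable

open Filter Asymptotics

/-! Suppose `f` is the submersion; the other case is symmetric. In suitable charts `f` is a
continuous linear map `π` with right inverse `σ`, and `g` is a `C^r`-map `k` into the same chart of
`N`. Near a given point the fibre product is then `{(v, w) | π v = k w}`. The shear `(v, w) ↦ (v - σ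
(k w), w)` is a `C^r`-diffeomorphism with inverse `(v, w) ↦ (v + σ (k w), w)`. It takes this set to
`ker π × E₂`, which is complemented by `range σ × 0`, and it fixes `w`. In the new chart the second
projection is therefore still linear, and it is split on the model space by `w ↦ (0, w)`. No inverse
function theorem is involved, so arbitrary locally convex spaces are allowed
(`exists_isAdapted_ker`, `isSplitSubmanifold_and_restrictsToSubmersion`).

It remains to pass from points to components. Adapted charts make the set locally connected, so its
components are open. At a common point of two adapted charts, the derivative of the change of charts
is an automorphism of the ambient space that maps one model subspace onto the other
(`IsAdapted.exists_equiv`). By connectedness, one model subspace serves a whole component.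

This uses only a few properties of `C^r`-maps: closure under composition and pairing, locality, and
the existence of a continuous linear Hadamard derivative. Most of the work is to prove them for each
regularity class. Michal-Bastiani maps are treated by the mean value theorem, complex analytic maps
by Cauchy estimates tested on continuous linear functionals, and real analytic maps by gluing
complex extensions with the identity theorem. -/

theorem hasFPowerSeriesOnBall_ofScalars {c : ℕ → ℂ} {k : ℂ → ℂ} {R : NNReal} (hR : 0 < R)
    (h : ∀ z : ℂ, ‖z‖ < R → HasSum (fun n => z ^ n * c n) (k z)) :
    HasFPowerSeriesOnBall k (FormalMultilinearSeries.ofScalars ℂ c) 0 R where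
  r_le := by
    refine ENNReal.le_of_forall_nnreal_lt fun s hs => ?_
    refine FormalMultilinearSeries.le_radius_of_summable_norm _ ?_
    have hs' : ‖((s : ℝ) : ℂ)‖ < R := by
      simpa using hs
    refine (h _ hs').summable.norm.congr fun n => ?_
    rw [FormalMultilinearSeries.ofScalars_norm, norm_mul, norm_pow, mul_comm]
    simp
  r_pos := by simpa using hR
  hasSum := by
    intro y hy
    have hy' : ‖y‖ < R := by simpa [enorm_eq_nnnorm, ← NNReal.coe_lt_coe] using hy
    simpa [FormalMultilinearSeries.ofScalars, mul_comm] using h y hy'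

/-- Cauchy's estimates for the coefficients of a bounded power series. -/
theorem norm_coeff_le_of_hasSum {c : ℕ → ℂ} {k : ℂ → ℂ} {ρ C : ℝ} (hρ : 0 < ρ)
    (h : ∀ z : ℂ, ‖z‖ < ρ → HasSum (fun n => z ^ n * c n) (k z))
    (hC : ∀ z : ℂ, ‖z‖ < ρ → ‖k z‖ ≤ C) (n : ℕ) : ‖c n‖ ≤ C / ρ ^ n := by
  lift ρ to NNReal using hρ.le
  have hk := hasFPowerSeriesOnBall_ofScalars (by exact_mod_cast hρ) h
  have hd : DifferentiableOn ℂ k (Metric.ball 0 ρ) := by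
    have := hk.differentiableOn
    rwa [Metric.eball_coe] at this
  have hco : (n.factorial : ℂ) * c n = iteratedDeriv n k 0 := by
    have := hk.factorial_smul 1 n
    rw [iteratedDeriv_eq_iteratedFDeriv, ← this]
    simp [FormalMultilinearSeries.ofScalars]
  -- Cauchy's estimate needs a closed disc inside the domain, hence a radius `r < ρ`; the bound for
  -- `ρ` itself is the limit `r → ρ`.
  have hle : ∀ r : ℝ, 0 < r → r < ρ → ‖c n‖ ≤ C / r ^ n := by
    intro r hr hrρ
    have := Complex.norm_iteratedDeriv_le_of_forall_mem_sphere_norm_le n hr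
      ((hd.mono (Metric.closedBall_subset_ball hrρ)).diffContOnCl_ball subset_rfl)
      (fun z hz => hC z (by rw [mem_sphere_zero_iff_norm] at hz; rwa [hz]))
    rw [← hco, norm_mul, mul_div_assoc] at this
    refine le_of_mul_le_mul_left (by simpa using this) (a := (n.factorial : ℝ)) (by positivity)
  have ht : Tendsto (fun r : ℝ => C / r ^ n) (𝓝[<] (ρ : ℝ)) (𝓝 (C / ρ ^ n)) := by
    refine Tendsto.mono_left ?_ nhdsWithin_le_nhds
    exact (continuousAt_const.div (continuousAt_id.pow n) (pow_ne_zero _ hρ.ne')).tendsto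
  refine ge_of_tendsto ht ?_
  filter_upwards [Ioo_mem_nhdsLT hρ] with r hr using hle r hr.1 hr.2

/-- Uniqueness of asymptotic expansions: once the lower coefficients vanish, `d n = O(z)`, and a
constant that tends to `0` is `0`. -/
theorem eq_zero_of_sum_isBigO {d : ℕ → ℂ}
    (h : ∀ N, (fun z : ℂ => ∑ n ∈ Finset.range N, z ^ n * d n) =O[𝓝[≠] 0] fun z => z ^ N) (n : ℕ) :
    d n = 0 := by
  induction n using Nat.strong_induction_on with
  | _ n ih =>
    have h1 := h (n + 1)
    have h2 : (fun z : ℂ => z ^ n * d n) =O[𝓝[≠] 0] fun z => z ^ n * z := by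
      refine h1.congr (fun z => ?_) fun z => pow_succ z n
      rw [Finset.sum_range_succ, Finset.sum_eq_zero, zero_add]
      intro m hm
      rw [ih m (Finset.mem_range.1 hm), mul_zero]
    have h3 : (fun _ : ℂ => d n) =O[𝓝[≠] 0] fun z => z := by
      obtain ⟨C, hC⟩ := h2.bound
      refine IsBigO.of_bound C ?_
      filter_upwards [hC, self_mem_nhdsWithin] with z hz hz0
      have hz0 : 0 < ‖z ^ n‖ := norm_pos_iff.2 (pow_ne_zero _ hz0)
      rw [norm_mul, norm_mul] at hz
      exact le_of_mul_le_mul_left (by linarith) hz0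
    have h4 : Tendsto (fun _ : ℂ => d n) (𝓝[≠] 0) (𝓝 0) :=
      h3.trans_tendsto (tendsto_id.mono_left nhdsWithin_le_nhds)
    exact tendsto_nhds_unique tendsto_const_nhds h4

/-- A holomorphic function is the sum of its asymptotic expansion at the centre of a disc. -/
theorem hasSum_of_asymptotic {c : ℕ → ℂ} {k : ℂ → ℂ} {ρ : ℝ}
    (hk : DifferentiableOn ℂ k (Metric.ball 0 ρ))
    (h : ∀ N, (fun z : ℂ => k z - ∑ n ∈ Finset.range N, z ^ n * c n) =O[𝓝[≠] 0] fun z => z ^ N)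
    {z : ℂ} (hz : ‖z‖ < ρ) : HasSum (fun n => z ^ n * c n) (k z) := by
  have hρ : 0 < ρ := (norm_nonneg z).trans_lt hz
  lift ρ to NNReal using hρ.le
  set a : ℕ → ℂ := fun n => (n.factorial : ℂ)⁻¹ * iteratedDeriv n k 0 with ha
  have hs : ∀ z : ℂ, ‖z‖ < ρ → HasSum (fun n => z ^ n * a n) (k z) := by
    intro z hz
    refine (Complex.hasSum_taylorSeries_on_ball hk (z := z) (by simpa using hz)).congr_fun ?_
    intro n
    simp only [ha, sub_zero, smul_eq_mul]; ring
  have hp := (hasFPowerSeriesOnBall_ofScalars (by exact_mod_cast hρ) hs).hasFPowerSeriesAt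
  have key : ∀ n, a n - c n = 0 := by
    refine eq_zero_of_sum_isBigO fun N => ?_
    have h1 : (fun z : ℂ => k z - ∑ n ∈ Finset.range N, z ^ n * a n) =O[𝓝[≠] 0]
        fun z => z ^ N := by
      have := (hp.isBigO_sub_partialSum_pow N).mono (nhdsWithin_le_nhds (s := {0}ᶜ))
      refine IsBigO.of_norm_right (this.congr (fun z => ?_) fun z => by simp)
      simp [FormalMultilinearSeries.partialSum, FormalMultilinearSeries.ofScalars, mul_comm]
    refine ((h N).sub h1).congr_left fun z => ?_
    simp only [mul_sub, Finset.sum_sub_distrib]; ring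
  have hac : a = c := funext fun n => sub_eq_zero.1 (key n)
  simpa [hac] using hs z hz

end OneVariable

/-! ### Seminorms and continuous linear functionals -/

section Seminorms

variable {𝕜 : Type*} [RCLike 𝕜] {G : Type*} [AddCommGroup G] [Module 𝕜 G] [TopologicalSpace G]
  [PolynormableSpace 𝕜 G]

/-- A continuous seminorm is the supremum of the absolute values of the continuous
linear functionals it dominates. -/
theorem seminorm_le_of_forall_dual {q : Seminorm 𝕜 G} (hq : Continuous q) {v : G} {c : ℝ}
    (h : ∀ l : G →L[𝕜] 𝕜, (∀ x, ‖l x‖ ≤ q x) → ‖l v‖ ≤ c) : q v ≤ c := by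
  by_cases hv : q v = 0
  · rw [hv]; exact (norm_nonneg _).trans (h 0 fun x => by simp)
  have hv0 : v ≠ 0 := fun h0 => hv (by rw [h0, map_zero])
  let e := LinearEquiv.toSpanNonzeroSingleton 𝕜 G v hv0
  -- The functional `t • v ↦ t * q v` is dominated by `q` on the line through `v`; its Hahn-Banach
  -- extension attains `q v` at `v`.
  let f : Module.Dual 𝕜 (Submodule.span 𝕜 {v}) := ((q v : ℝ) : 𝕜) • (e.symm : _ →ₗ[𝕜] 𝕜)
  have hf : ∀ x, ‖f x‖ ≤ q x := by
    intro x
    obtain ⟨t, rfl⟩ := e.surjective x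
    have : ((e t : Submodule.span 𝕜 {v}) : G) = t • v := rfl
    rw [this, map_smul_eq_mul]
    simp [f, norm_smul, abs_of_nonneg (apply_nonneg q v), mul_comm]
  obtain ⟨g, hg, hle⟩ := Module.Dual.exists_continuous_extension_of_le_seminorm _ f hq hf
  have h1 := h g hle
  have h2 := hg (e 1)
  have h3 : ((e 1 : Submodule.span 𝕜 {v}) : G) = v := by
    change (1 : 𝕜) • v = v; simp
  rw [h3] at h2
  rw [h2] at h1
  simpa [f, abs_of_nonneg (apply_nonneg q v)] using h1

theorem tendsto_iff_seminorm {α : Type*} {u : α → G} {l : Filter α} {y : G} :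
    Filter.Tendsto u l (𝓝 y) ↔ ∀ q : Seminorm 𝕜 G, Continuous q → ∀ ε > 0,
      ∀ᶠ x in l, q (u x - y) < ε := by
  rw [(PolynormableSpace.withSeminorms 𝕜 G).tendsto_nhds]
  exact ⟨fun h q hq => h ⟨q, hq⟩, fun h q => h q.1 q.2⟩

/-- The continuous linear functionals on a Hausdorff locally convex space separate points. -/
theorem eq_of_forall_dual_eq [T2Space G] [IsTopologicalAddGroup G] {v w : G}
    (h : ∀ l : G →L[𝕜] 𝕜, l v = l w) : v = w := by
  by_contra hne
  obtain ⟨q, hq⟩ := (PolynormableSpace.withSeminorms 𝕜 G).separating_of_T1 (v - w)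
    (sub_ne_zero.2 hne)
  refine hq (le_antisymm (seminorm_le_of_forall_dual q.2 fun l _ => ?_) (apply_nonneg _ _))
  rw [map_sub, h, sub_self, norm_zero]

end Seminorms

/-! ### Hadamard derivatives -/

/-- `A` is the Hadamard derivative of `f` at `x`. -/
def HasHadamardDeriv (𝕜 : Type*) [RCLike 𝕜] {E F : Type*} [AddCommGroup E] [Module 𝕜 E]
    [TopologicalSpace E] [AddCommGroup F] [Module 𝕜 F] [TopologicalSpace F]
    (f A : E → F) (x : E) : Prop :=
  ∀ y, Filter.Tendsto (fun p : E × 𝕜 => p.2⁻¹ • (f (x + p.2 • p.1) - f x))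
    (𝓝 y ×ˢ 𝓝[≠] 0) (𝓝 (A y))

/-! ### Local power series expansions -/

section Series

open Filter Asymptotics

variable {E F G : Type*}
  [AddCommGroup E] [Module ℂ E] [TopologicalSpace E] [IsTopologicalAddGroup E] [ContinuousSMul ℂ E]
  [AddCommGroup F] [Module ℂ F] [TopologicalSpace F] [IsTopologicalAddGroup F] [ContinuousSMul ℂ F]
  [AddCommGroup G] [Module ℂ G] [TopologicalSpace G] [IsTopologicalAddGroup G] [ContinuousSMul ℂ G]

/-- `f` is the pointwise sum of the series `β` of homogeneous polynomials around `x`. -/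
def HasSeriesAt (f : E → F) (β : FormalMultilinearSeries ℂ E F) (x : E) : Prop :=
  ∀ᶠ y in 𝓝 (0 : E), HasSum (fun n => β n fun _ => y) (f (x + y))

theorem HasSeriesAt.coeff_zero [T2Space F] {f : E → F} {β : FormalMultilinearSeries ℂ E F} {x : E}
    (h : HasSeriesAt f β x) (v : Fin 0 → E) : β 0 v = f x := by
  have h0 := h.self_of_nhds
  rw [add_zero] at h0
  refine (hasSum_single 0 fun n hn => ?_).unique h0 |>.symm ▸ ?_
  · have : Nonempty (Fin n) := ⟨⟨0, Nat.pos_of_ne_zero hn⟩⟩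
    exact (β n).map_zero
  · congr 1; exact Subsingleton.elim _ _

theorem smul_const_apply (β : FormalMultilinearSeries ℂ E F) (n : ℕ) (z : ℂ) (y : E) :
    (β n fun _ => z • y) = z ^ n • β n fun _ => y := by
  simpa using (β n).map_smul_univ (fun _ => z) fun _ => y

/-- Joint continuity of scalar multiplication gives one radius for all directions near `w`; this
makes the remainder estimates uniform in the direction. -/
theorem exists_ball_smul_mem {V : Set E} (hV : V ∈ 𝓝 (0 : E)) (w : E) :
    ∃ ρ > 0, ∀ᶠ w' in 𝓝 w, ∀ z : ℂ, ‖z‖ < ρ → z • w' ∈ V := by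
  have hc : Tendsto (fun p : E × ℂ => p.2 • p.1) (𝓝 w ×ˢ 𝓝 0) (𝓝 0) := by
    rw [← nhds_prod_eq]
    have : Continuous fun p : E × ℂ => p.2 • p.1 := by fun_prop
    simpa using this.tendsto (w, (0 : ℂ))
  obtain ⟨W, hW, D, hD, hWD⟩ := mem_prod_iff.1 (hc hV)
  obtain ⟨ρ, hρ, hρD⟩ := Metric.mem_nhds_iff.1 hD
  refine ⟨ρ, hρ, ?_⟩
  filter_upwards [hW] with w' hw' z hz
  exact hWD (mk_mem_prod hw' (hρD (by simpa using hz)))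

/-- By Cauchy's estimates the tail is dominated by a geometric series. On the disc of half the
radius its ratio is at most `1 / 2`, whence the factor `2`. -/
theorem norm_sub_sum_le_of_hasSum {c : ℕ → ℂ} {k : ℂ → ℂ} {ρ C : ℝ} (hρ : 0 < ρ)
    (h : ∀ z : ℂ, ‖z‖ < ρ → HasSum (fun n => z ^ n * c n) (k z))
    (hC : ∀ z : ℂ, ‖z‖ < ρ → ‖k z‖ ≤ C) (N : ℕ) {z : ℂ} (hz : ‖z‖ ≤ ρ / 2) :
    ‖k z - ∑ n ∈ Finset.range N, z ^ n * c n‖ ≤ 2 * C / ρ ^ N * ‖z‖ ^ N := by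
  have hC0 : 0 ≤ C := (norm_nonneg _).trans (hC 0 (by simpa))
  have hs := (hasSum_nat_add_iff' N).2 (h z (by linarith))
  have hterm : ∀ n, ‖z ^ (n + N) * c (n + N)‖ ≤ C / ρ ^ N * ‖z‖ ^ N * (1 / 2) ^ n := by
    intro n
    have h1 := norm_coeff_le_of_hasSum hρ h hC (n + N)
    have h2 : (‖z‖ / ρ) ^ n ≤ (1 / 2) ^ n := by
      refine pow_le_pow_left₀ (by positivity) ?_ n
      rw [div_le_iff₀ hρ]; linarith
    calc ‖z ^ (n + N) * c (n + N)‖ ≤ ‖z‖ ^ (n + N) * (C / ρ ^ (n + N)) := by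
          rw [norm_mul, norm_pow]; gcongr
      _ = C / ρ ^ N * ‖z‖ ^ N * (‖z‖ / ρ) ^ n := by
          rw [div_pow, pow_add, pow_add]; field_simp
      _ ≤ _ := by gcongr
  have hg := hasSum_geometric_two.mul_left (C / ρ ^ N * ‖z‖ ^ N)
  calc _ ≤ C / ρ ^ N * ‖z‖ ^ N * 2 := by
        rw [← hs.tsum_eq]; exact tsum_of_norm_bounded hg hterm
    _ = _ := by ring

/-- The remainders of a local power series expansion, uniformly in the direction. -/
theorem HasSeriesAt.remainder_le [PolynormableSpace ℂ G] {g : F → G}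
    {γ : FormalMultilinearSeries ℂ F G} {a : F} (h : HasSeriesAt g γ a) (hg : ContinuousAt g a)
    {q : Seminorm ℂ G} (hq : Continuous q) (w : F) (N : ℕ) :
    ∃ C, ∀ᶠ p : F × ℂ in 𝓝 w ×ˢ 𝓝 0,
      q (g (a + p.2 • p.1) - ∑ m ∈ Finset.range N, p.2 ^ m • γ m fun _ => p.1) ≤ C * ‖p.2‖ ^ N := by
  have hb : ∀ᶠ y in 𝓝 (0 : F), q (g (a + y)) < q (g a) + 1 := by
    have h1 : Tendsto (fun y => g (a + y)) (𝓝 0) (𝓝 (g a)) := by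
      refine Tendsto.comp (y := 𝓝 a) hg ?_
      simpa using ((continuous_const_add a).tendsto (0 : F))
    exact ((hq.tendsto _).comp h1).eventually_lt_const (by linarith)
  obtain ⟨ρ, hρ, hW⟩ := exists_ball_smul_mem (h.and hb) w
  refine ⟨2 * (q (g a) + 1) / ρ ^ N, ?_⟩
  filter_upwards [hW.prod_mk (Metric.closedBall_mem_nhds (0 : ℂ) (half_pos hρ))] with p hp
  obtain ⟨hp1, hp2⟩ := hp
  -- All functionals dominated by `q` obey the same bound `q (g a) + 1` on the disc, so the constant
  -- of the scalar estimate depends neither on `l` nor on the direction.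
  refine seminorm_le_of_forall_dual hq fun l hl => ?_
  have hps : ∀ z : ℂ, ‖z‖ < ρ → HasSum (fun n => z ^ n * l (γ n fun _ => p.1))
      (l (g (a + z • p.1))) := by
    intro z hz
    refine ((hp1 z hz).1.mapL l).congr_fun fun n => ?_
    rw [smul_const_apply, map_smul, smul_eq_mul]
  have := norm_sub_sum_le_of_hasSum hρ hps
    (fun z hz => (hl _).trans (hp1 z hz).2.le) N (z := p.2) (by simpa using hp2)
  simpa [map_sub, map_sum] using this

/-- The remainder after `N + 1` terms is `O(z ^ (N + 1))`, so after division by `z ^ N` only the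
term of degree `N` survives. The case `N = 1` is the Hadamard derivative; general `N` controls the
Taylor error of the inner map of a composition. -/
theorem HasSeriesAt.tendsto_remainder [PolynormableSpace ℂ G] {g : F → G}
    {γ : FormalMultilinearSeries ℂ F G} {a : F} (h : HasSeriesAt g γ a) (hg : ContinuousAt g a)
    (w : F) (N : ℕ) :
    Tendsto (fun p : F × ℂ => (p.2 ^ N)⁻¹ •
        (g (a + p.2 • p.1) - ∑ m ∈ Finset.range N, p.2 ^ m • γ m fun _ => p.1))
      (𝓝 w ×ˢ 𝓝[≠] 0) (𝓝 (γ N fun _ => w)) := by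
  have hle : 𝓝 w ×ˢ 𝓝[≠] (0 : ℂ) ≤ 𝓝 w ×ˢ 𝓝 0 := prod_mono le_rfl nhdsWithin_le_nhds
  have h1 : Tendsto (fun p : F × ℂ => (p.2 ^ N)⁻¹ •
      (g (a + p.2 • p.1) - ∑ m ∈ Finset.range (N + 1), p.2 ^ m • γ m fun _ => p.1))
      (𝓝 w ×ˢ 𝓝[≠] 0) (𝓝 0) := by
    rw [tendsto_iff_seminorm (𝕜 := ℂ)]
    intro q hq ε hε
    obtain ⟨C, hC⟩ := h.remainder_le hg hq w (N + 1)
    have h0 : Tendsto (fun p : F × ℂ => C * ‖p.2‖) (𝓝 w ×ˢ 𝓝[≠] 0) (𝓝 0) := by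
      have : Tendsto (fun p : F × ℂ => C * ‖p.2‖) (𝓝 w ×ˢ 𝓝 0) (𝓝 (C * ‖(0 : ℂ)‖)) :=
        (tendsto_snd.norm).const_mul C
      rw [norm_zero, mul_zero] at this
      exact this.mono_left hle
    have hne : ∀ᶠ p : F × ℂ in 𝓝 w ×ˢ 𝓝[≠] 0, p.2 ≠ 0 :=
      tendsto_snd.eventually self_mem_nhdsWithin
    filter_upwards [hle hC, h0.eventually_lt_const hε, hne] with p hp hp' hp0
    refine lt_of_le_of_lt ?_ hp'
    have hz : 0 < ‖p.2‖ ^ N := pow_pos (norm_pos_iff.2 hp0) N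
    rw [sub_zero, map_smul_eq_mul, norm_inv, norm_pow, inv_mul_le_iff₀ hz]
    calc _ ≤ _ := hp
      _ = _ := by ring
  have h2 : Tendsto (fun p : F × ℂ => γ N fun _ => p.1) (𝓝 w ×ˢ 𝓝[≠] 0)
      (𝓝 (γ N fun _ => w)) := by
    have : Continuous fun w : F => γ N fun _ => w := by fun_prop
    exact (this.tendsto w).comp tendsto_fst
  have h3 := h1.add h2
  rw [zero_add] at h3
  refine h3.congr' ?_
  have hne : ∀ᶠ p : F × ℂ in 𝓝 w ×ˢ 𝓝[≠] 0, p.2 ≠ 0 :=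
    tendsto_snd.eventually self_mem_nhdsWithin
  filter_upwards [hne] with p hp
  rw [Finset.sum_range_succ, ← sub_sub, smul_sub _ _ (p.2 ^ N • _), smul_smul,
    inv_mul_cancel₀ (pow_ne_zero _ hp), one_smul, sub_add_cancel]

theorem HasSeriesAt.hasHadamardDeriv [PolynormableSpace ℂ G] [T2Space G] {g : F → G}
    {γ : FormalMultilinearSeries ℂ F G} {a : F} (h : HasSeriesAt g γ a) (hg : ContinuousAt g a) :
    HasHadamardDeriv ℂ g (fun w => γ 1 fun _ => w) a := by
  intro w
  refine (h.tendsto_remainder hg w 1).congr fun p => ?_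
  simp [h.coeff_zero]

/-- The analogue of `FormalMultilinearSeries.comp_partialSum` in topological vector spaces. -/
theorem sum_apply_partialSum_eq (q : FormalMultilinearSeries ℂ F G)
    (p : FormalMultilinearSeries ℂ E F) (M N : ℕ) (y : E) :
    ∑ n ∈ Finset.range M, q n (fun _ => ∑ i ∈ Finset.Ico 1 N, p i fun _ => y) =
      ∑ i ∈ FormalMultilinearSeries.compPartialSumTarget 0 M N,
        q.compAlongComposition p i.2 fun _ => y := by
  suffices H : (∑ n ∈ Finset.range M, ∑ r ∈ Fintype.piFinset fun _ : Fin n => Finset.Ico 1 N,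
        q n fun i : Fin n => p (r i) fun _ => y) =
      ∑ i ∈ FormalMultilinearSeries.compPartialSumTarget 0 M N,
        q.compAlongComposition p i.2 fun _ => y by
    simpa only [ContinuousMultilinearMap.map_sum_finset] using H
  rw [Finset.range_eq_Ico, Finset.sum_sigma']
  apply FormalMultilinearSeries.compChangeOfVariables_sum 0 M N
  rintro ⟨k, blocks_fun⟩ H
  apply FormalMultilinearSeries.congr _ (FormalMultilinearSeries.compChangeOfVariables_length 0 M N H).symm
  intros
  rw [← FormalMultilinearSeries.compChangeOfVariables_blocksFun 0 M N H,
    FormalMultilinearSeries.applyComposition, Function.comp_def]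

/-- A multilinear map changes by `O(z ^ N)` if its argument does. -/
theorem isBigO_multilinear_add {m : ℕ} (γ : ContinuousMultilinearMap ℂ (fun _ : Fin m => F) ℂ)
    {u e : ℂ → F} {u₀ e₀ : F} (hu : Tendsto u (𝓝[≠] 0) (𝓝 u₀)) (he : Tendsto e (𝓝[≠] 0) (𝓝 e₀))
    (N : ℕ) :
    (fun z => γ (fun _ => u z + z ^ N • e z) - γ fun _ => u z) =O[𝓝[≠] 0] fun z : ℂ => z ^ N := by
  classical
  -- Multilinear expansion: `s` is the set of slots filled by `u`, and every other slot contributes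
  -- a factor `z ^ N`. Only `s = univ` has no such factor, and that term is the one subtracted.
  have hexp : ∀ z : ℂ, γ (fun _ => u z + z ^ N • e z) - γ (fun _ => u z) =
      ∑ s ∈ Finset.univ.erase (Finset.univ : Finset (Fin m)),
        (z ^ N) ^ (sᶜ.card) * γ (s.piecewise (fun _ => u z) fun _ => e z) := by
    intro z
    have h1 := γ.toMultilinearMap.map_add_univ (fun _ => u z) fun _ => z ^ N • e z
    have h2 : γ (fun _ => u z + z ^ N • e z) =
        ∑ s : Finset (Fin m), γ (s.piecewise (fun _ => u z) fun _ => z ^ N • e z) := h1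
    rw [h2, ← Finset.sum_erase_add _ _ (Finset.mem_univ (Finset.univ : Finset (Fin m)))]
    rw [Finset.piecewise_univ, add_sub_cancel_right]
    refine Finset.sum_congr rfl fun s _ => ?_
    have h3 : s.piecewise (fun _ => u z) (fun _ => z ^ N • e z) =
        fun i => (if i ∈ s then (1 : ℂ) else z ^ N) • s.piecewise (fun _ => u z) (fun _ => e z) i := by
      funext i
      by_cases hi : i ∈ s <;> simp [hi]
    have h4 : ∏ i : Fin m, (if i ∈ s then (1 : ℂ) else z ^ N) = (z ^ N) ^ (sᶜ.card) := by
      rw [Finset.prod_ite]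
      simp only [Finset.prod_const, one_pow, one_mul]
      congr 2; ext i; simp
    rw [h3, γ.map_smul_univ, h4, smul_eq_mul]
  refine IsBigO.congr_left ?_ fun z => (hexp z).symm
  refine IsBigO.fun_sum fun s hs => ?_
  have hs1 : 1 ≤ sᶜ.card := by
    rw [Nat.one_le_iff_ne_zero, Ne, Finset.card_eq_zero, Finset.compl_eq_empty_iff]
    exact (Finset.mem_erase.1 hs).1
  have hb : (fun z => γ (s.piecewise (fun _ => u z) fun _ => e z)) =O[𝓝[≠] 0]
      fun _ => (1 : ℂ) := by
    have ht : Tendsto (fun z => s.piecewise (fun _ : Fin m => u z) fun _ => e z) (𝓝[≠] 0)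
        (𝓝 (s.piecewise (fun _ => u₀) fun _ => e₀)) := by
      refine tendsto_pi_nhds.2 fun i => ?_
      by_cases hi : i ∈ s <;> simpa [hi]
    exact ((γ.cont.tendsto _).comp ht).isBigO_one ℂ
  have hz : (fun z : ℂ => (z ^ N) ^ (sᶜ.card)) =O[𝓝[≠] 0] fun z => z ^ N := by
    obtain ⟨j, hj⟩ := Nat.exists_eq_add_of_le hs1
    have h1 : (fun z : ℂ => (z ^ N) ^ j) =O[𝓝[≠] 0] fun _ => (1 : ℂ) := by
      have : Continuous fun z : ℂ => (z ^ N) ^ j := by fun_prop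
      exact ((this.tendsto 0).mono_left nhdsWithin_le_nhds).isBigO_one ℂ
    rw [hj]
    simpa [pow_add] using (isBigO_refl (fun z : ℂ => z ^ N) (𝓝[≠] 0)).mul h1
  simpa using hz.mul hb

end Series

/-! ### Composition of power series. -/

section Series

open Filter Asymptotics

variable {E F G : Type*}
  [AddCommGroup E] [Module ℂ E] [TopologicalSpace E] [IsTopologicalAddGroup E] [ContinuousSMul ℂ E]
  [AddCommGroup F] [Module ℂ F] [TopologicalSpace F] [IsTopologicalAddGroup F] [ContinuousSMul ℂ F]
  [AddCommGroup G] [Module ℂ G] [TopologicalSpace G] [IsTopologicalAddGroup G] [ContinuousSMul ℂ G]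

theorem pow_isBigO_pow {m n : ℕ} (h : n ≤ m) :
    (fun z : ℂ => z ^ m) =O[𝓝[≠] 0] fun z => z ^ n := by
  obtain ⟨j, rfl⟩ := Nat.exists_eq_add_of_le h
  have h1 : (fun z : ℂ => z ^ j) =O[𝓝[≠] 0] fun _ => (1 : ℂ) := by
    have : Continuous fun z : ℂ => z ^ j := by fun_prop
    exact ((this.tendsto 0).mono_left nhdsWithin_le_nhds).isBigO_one ℂ
  simpa [pow_add] using (isBigO_refl (fun z : ℂ => z ^ n) (𝓝[≠] 0)).mul h1

/-- A composition of `n < N` has length and blocks below `N`, so the truncated series already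
produce every term of `q.comp p` of degree below `N`. The difference contains only monomials `z ^ n`
with `n ≥ N`. -/
theorem isBigO_sum_apply_partialSum_sub (q : FormalMultilinearSeries ℂ F G)
    (p : FormalMultilinearSeries ℂ E F) (N : ℕ) (y : E) (l : G →L[ℂ] ℂ) :
    (fun z : ℂ => ∑ m ∈ Finset.range N,
        l (q m fun _ => ∑ i ∈ Finset.Ico 1 N, p i fun _ => z • y) -
      ∑ n ∈ Finset.range N, z ^ n * l (q.comp p n fun _ => y)) =O[𝓝[≠] 0] fun z => z ^ N := by
  classical
  set T := FormalMultilinearSeries.compPartialSumTarget 0 N N with hT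
  have hlow : T.filter (fun i => i.1 < N) =
      (Finset.range N).sigma fun n => (Finset.univ : Finset (Composition n)) := by
    ext ⟨n, c⟩
    simp only [hT, Finset.mem_filter, FormalMultilinearSeries.mem_compPartialSumTarget_iff,
      Finset.mem_sigma, Finset.mem_range, Finset.mem_univ, and_true]
    refine ⟨fun h => h.2, fun h => ⟨⟨Nat.zero_le _, c.length_le.trans_lt h, fun j => ?_⟩, h⟩⟩
    exact (c.blocksFun_le j).trans_lt h
  have h1 : ∀ z : ℂ, ∑ m ∈ Finset.range N,
        l (q m fun _ => ∑ i ∈ Finset.Ico 1 N, p i fun _ => z • y) -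
      ∑ n ∈ Finset.range N, z ^ n * l (q.comp p n fun _ => y) =
      ∑ i ∈ T.filter (fun i => ¬ i.1 < N), z ^ i.1 *
        l (q.compAlongComposition p i.2 fun _ => y) := by
    intro z
    rw [← map_sum, sum_apply_partialSum_eq, map_sum]
    have hz : ∀ i : Σ n, Composition n, l (q.compAlongComposition p i.2 fun _ => z • y) =
        z ^ i.1 * l (q.compAlongComposition p i.2 fun _ => y) := by
      intro i
      have : (q.compAlongComposition p i.2 fun _ => z • y) =
          z ^ i.1 • (q.compAlongComposition p i.2 fun _ => y) := by
        simpa using (q.compAlongComposition p i.2).map_smul_univ (fun _ => z) fun _ => y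
      rw [this, map_smul, smul_eq_mul]
    simp_rw [hz]
    rw [← Finset.sum_filter_add_sum_filter_not T (fun i => i.1 < N), hlow, Finset.sum_sigma]
    have : ∀ n, z ^ n * l (q.comp p n fun _ => y) =
        ∑ c : Composition n, z ^ n * l (q.compAlongComposition p c fun _ => y) := by
      intro n
      rw [FormalMultilinearSeries.comp, sum_apply, map_sum, Finset.mul_sum]
    simp_rw [this]
    ring
  refine IsBigO.congr_left ?_ fun z => (h1 z).symm
  refine IsBigO.fun_sum fun i hi => ?_
  have hi : N ≤ i.1 := not_lt.1 (Finset.mem_filter.1 hi).2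
  simpa [mul_comm] using (pow_isBigO_pow hi).const_mul_left (l (q.compAlongComposition p i.2 fun _ => y))

/-- The asymptotic expansion of a composition along a line. -/
theorem HasSeriesAt.comp_isBigO [PolynormableSpace ℂ F] [T2Space F] [PolynormableSpace ℂ G]
    {f : E → F} {g : F → G} {β : FormalMultilinearSeries ℂ E F}
    {γ : FormalMultilinearSeries ℂ F G} {x : E} (hf : HasSeriesAt f β x) (hfc : ContinuousAt f x)
    (hg : HasSeriesAt g γ (f x)) (hgc : ContinuousAt g (f x)) (y : E) (l : G →L[ℂ] ℂ) (N : ℕ) :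
    (fun z : ℂ => l (g (f (x + z • y))) - ∑ n ∈ Finset.range N, z ^ n * l (γ.comp β n fun _ => y))
      =O[𝓝[≠] 0] fun z => z ^ N := by
  have hline : Tendsto (fun z : ℂ => (y, z)) (𝓝[≠] 0) (𝓝 y ×ˢ 𝓝[≠] 0) :=
    tendsto_const_nhds.prodMk tendsto_id
  -- For `N = 0` the claim is boundedness near `0`; for `N > 0` the constant term `f x` can be split
  -- off the Taylor polynomial of `f`.
  rcases Nat.eq_zero_or_pos N with rfl | hN
  · simp only [Finset.range_zero, Finset.sum_empty, sub_zero, pow_zero]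
    have h1 : Tendsto (fun z : ℂ => x + z • y) (𝓝[≠] 0) (𝓝 x) := by
      have : Continuous fun z : ℂ => x + z • y := by fun_prop
      simpa using (this.tendsto 0).mono_left nhdsWithin_le_nhds
    exact ((l.continuous.tendsto _).comp (hgc.tendsto.comp (hfc.tendsto.comp h1))).isBigO_one ℂ
  have hne : ∀ᶠ z : ℂ in 𝓝[≠] 0, z ≠ 0 := self_mem_nhdsWithin
  -- replace `g` by its Taylor polynomial
  have h1 : (fun z : ℂ => l (g (f (x + z • y))) -
      ∑ m ∈ Finset.range N, l (γ m fun _ => f (x + z • y) - f x)) =O[𝓝[≠] 0] fun z => z ^ N := by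
    let q : Seminorm ℂ G := (normSeminorm ℂ ℂ).comp (l : G →ₗ[ℂ] ℂ)
    have hq : Continuous q := l.continuous.norm
    have hw := ((hf.hasHadamardDeriv hfc) y).comp hline
    -- The bound is applied in the moving direction `z⁻¹ • (f (x + z • y) - f x)`, which tends to `β
    -- 1 y`; uniformity in the direction is essential here.
    obtain ⟨C, hC⟩ := hg.remainder_le hgc hq (β 1 fun _ => y) N
    refine IsBigO.of_bound C ?_
    have hz0 : Tendsto (fun z : ℂ => z) (𝓝[≠] 0) (𝓝 0) := tendsto_id.mono_left nhdsWithin_le_nhds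
    filter_upwards [(hw.prodMk hz0).eventually hC, hne] with z hz hz0
    have e1 : z • z⁻¹ • (f (x + z • y) - f x) = f (x + z • y) - f x := smul_inv_smul₀ hz0 _
    have e2 : ∀ m, z ^ m • (γ m fun _ => z⁻¹ • (f (x + z • y) - f x)) =
        γ m fun _ => f (x + z • y) - f x := by
      intro m
      rw [← smul_const_apply, e1]
    simp only [Function.comp_apply, e1, e2, add_sub_cancel] at hz
    rw [norm_pow]
    simpa [q, map_sub, map_sum] using hz
  -- replace `f` by its Taylor polynomial
  have h2 : (fun z : ℂ => ∑ m ∈ Finset.range N, l (γ m fun _ => f (x + z • y) - f x) -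
      ∑ m ∈ Finset.range N, l (γ m fun _ => ∑ i ∈ Finset.Ico 1 N, β i fun _ => z • y))
      =O[𝓝[≠] 0] fun z => z ^ N := by
    simp_rw [← Finset.sum_sub_distrib]
    refine IsBigO.fun_sum fun m _ => ?_
    have he := (hf.tendsto_remainder hfc y N).comp hline
    have hu : Tendsto (fun z : ℂ => ∑ i ∈ Finset.Ico 1 N, β i fun _ => z • y) (𝓝[≠] 0)
        (𝓝 (∑ i ∈ Finset.Ico 1 N, β i fun _ => (0 : ℂ) • y)) := by
      have : Continuous fun z : ℂ => ∑ i ∈ Finset.Ico 1 N, β i fun _ => z • y := by fun_prop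
      exact (this.tendsto 0).mono_left nhdsWithin_le_nhds
    refine (isBigO_multilinear_add (l.compContinuousMultilinearMap (γ m)) hu he N).congr' ?_
      EventuallyEq.rfl
    filter_upwards [hne] with z hz
    have hsum : ∑ i ∈ Finset.range N, z ^ i • (β i fun _ => y) =
        f x + ∑ i ∈ Finset.Ico 1 N, β i fun _ => z • y := by
      rw [Finset.range_eq_Ico, Finset.sum_eq_sum_Ico_succ_bot hN]
      simp [smul_const_apply, hf.coeff_zero]
    have hsub : (∑ i ∈ Finset.Ico 1 N, β i fun _ => z • y) + z ^ N • (z ^ N)⁻¹ •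
        (f (x + z • y) - ∑ i ∈ Finset.range N, z ^ i • (β i fun _ => y)) = f (x + z • y) - f x := by
      rw [smul_inv_smul₀ (pow_ne_zero _ hz), hsum]; abel
    simp only [Function.comp_apply, hsub, ContinuousLinearMap.compContinuousMultilinearMap_coe]
  refine ((h1.add h2).add (isBigO_sum_apply_partialSum_sub γ β N y l)).congr_left fun z => ?_
  ring

/-- A weakly holomorphic continuous curve with Taylor coefficients in the space itself is
the sum of its Taylor series. -/
theorem hasSum_of_weak [PolynormableSpace ℂ G] {h : ℂ → G} {d : ℕ → G}
    (hc : ContinuousOn h (Metric.ball 0 2))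
    (hs : ∀ l : G →L[ℂ] ℂ, ∀ z : ℂ, ‖z‖ < 2 → HasSum (fun n => z ^ n * l (d n)) (l (h z))) :
    HasSum d (h 1) := by
  rw [HasSum, SummationFilter.unconditional_filter, tendsto_iff_seminorm (𝕜 := ℂ)]
  intro q hq ε hε
  -- Any radius strictly between `1` and `2` would do: the closed disc is compact in the domain, and
  -- the coefficients then decay geometrically at `z = 1`.
  obtain ⟨C, hC⟩ : ∃ C, ∀ z ∈ Metric.closedBall (0 : ℂ) (3 / 2), ‖q (h z)‖ ≤ C := by
    refine (isCompact_closedBall (0 : ℂ) (3 / 2)).exists_bound_of_continuousOn ?_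
    exact hq.comp_continuousOn (hc.mono (Metric.closedBall_subset_ball (by norm_num)))
  -- The bound is the same for every `l` dominated by `q`, so the weak tails are small uniformly in
  -- `l`, that is, with respect to `q`. Completeness plays no role, since the limit `h 1` is given.
  have hcoef : ∀ l : G →L[ℂ] ℂ, (∀ x, ‖l x‖ ≤ q x) → ∀ n, ‖l (d n)‖ ≤ C * (2 / 3) ^ n := by
    intro l hl n
    have := norm_coeff_le_of_hasSum (c := fun n => l (d n)) (k := fun z => l (h z)) (ρ := 3 / 2)
      (C := C) (by norm_num) (fun z hz => hs l z (by linarith)) (fun z hz => by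
        refine (hl _).trans ((le_abs_self _).trans (hC z ?_))
        simpa using hz.le) n
    refine this.trans (le_of_eq ?_)
    rw [div_eq_mul_inv, ← inv_pow]; norm_num
  have hsum : Summable fun n : ℕ => C * (2 / 3 : ℝ) ^ n :=
    (summable_geometric_of_lt_one (by norm_num) (by norm_num)).mul_left C
  filter_upwards [(tendsto_tsum_compl_atTop_zero fun n : ℕ => C * (2 / 3 : ℝ) ^ n).eventually_lt_const
    hε] with s hs'
  refine lt_of_le_of_lt ?_ hs'
  refine seminorm_le_of_forall_dual hq fun l hl => ?_
  have h1 : HasSum (fun n => l (d n)) (l (h 1)) := by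
    simpa using hs l 1 (by norm_num)
  have h2 : HasSum (fun n : {n // n ∉ s} => l (d n)) (l (h 1) - ∑ n ∈ s, l (d n)) := by
    rw [Finset.hasSum_compl_iff s (f := fun n => l (d n))]
    simpa using h1
  have h3 : HasSum (fun n : {n // n ∉ s} => C * (2 / 3 : ℝ) ^ (n : ℕ))
      (∑' n : {n // n ∉ s}, C * (2 / 3 : ℝ) ^ (n : ℕ)) :=
    (hsum.subtype {n | n ∉ s}).hasSum
  have h4 := tsum_of_norm_bounded h3 fun n : {n // n ∉ s} => hcoef l hl n
  rw [h2.tsum_eq] at h4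
  rw [map_sub, map_sum, norm_sub_rev]
  exact h4

theorem IsComplexAnalytic.hasSeriesAt {U : Set E} {f : E → F}
    (hf : IsComplexAnalytic U f) {x : E} (hx : x ∈ U) :
    ∃ β : FormalMultilinearSeries ℂ E F, HasSeriesAt f β x := by
  obtain ⟨V, hV, β, hβ⟩ := hf.2 x hx
  exact ⟨β, Filter.mem_of_superset hV fun y hy => (hβ y hy).2⟩

theorem eventually_add_mem {U : Set E} (hU : IsOpen U) {x : E} (hx : x ∈ U) :
    ∀ᶠ y in 𝓝 (0 : E), x + y ∈ U := by
  have : Tendsto (fun y => x + y) (𝓝 0) (𝓝 x) := by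
    simpa using (continuous_const_add x).tendsto (0 : E)
  exact this (hU.mem_nhds hx)

theorem isComplexAnalytic_iff {U : Set E} (hU : IsOpen U) {f : E → F} :
    IsComplexAnalytic U f ↔ ContinuousOn f U ∧
      ∀ x ∈ U, ∃ β : FormalMultilinearSeries ℂ E F, HasSeriesAt f β x := by
  refine ⟨fun h => ⟨h.1, fun x hx => h.hasSeriesAt hx⟩, fun h => ⟨h.1, fun x hx => ?_⟩⟩
  obtain ⟨β, hβ⟩ := h.2 x hx
  exact ⟨_, (eventually_add_mem hU hx).and hβ, β, fun y hy => hy⟩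

/-- The composed formal series is only known to be an asymptotic expansion along each line. Having
one at every point of a line makes each `l ∘ g ∘ f` holomorphic there, so the expansion at `x` is
its Taylor series and converges; `hasSum_of_weak` lifts the convergence from functionals to `G`. -/
theorem IsComplexAnalytic.comp [PolynormableSpace ℂ F] [T2Space F] [PolynormableSpace ℂ G]
    [T2Space G] {U : Set E} {V : Set F} (hU : IsOpen U) (hV : IsOpen V) {f : E → F} {g : F → G}
    (hg : IsComplexAnalytic V g) (hf : IsComplexAnalytic U f) (hUV : MapsTo f U V) :
    IsComplexAnalytic U (g ∘ f) := by
  have hcont : ContinuousOn (g ∘ f) U := hg.1.comp hf.1 hUV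
  rw [isComplexAnalytic_iff hU]
  refine ⟨hcont, fun x hx => ?_⟩
  have hexp : ∀ x' ∈ U, ∃ δ : FormalMultilinearSeries ℂ E G, ∀ (y : E) (l : G →L[ℂ] ℂ) (N : ℕ),
      (fun z : ℂ => l (g (f (x' + z • y))) - ∑ n ∈ Finset.range N, z ^ n * l (δ n fun _ => y))
      =O[𝓝[≠] 0] fun z => z ^ N := by
    intro x' hx'
    obtain ⟨β, hβ⟩ := hf.hasSeriesAt hx'
    obtain ⟨γ, hγ⟩ := hg.hasSeriesAt (hUV hx')
    exact ⟨γ.comp β, fun y l N => hβ.comp_isBigO (hf.1.continuousAt (hU.mem_nhds hx'))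
      hγ (hg.1.continuousAt (hV.mem_nhds (hUV hx'))) y l N⟩
  have hline : ∀ (x' y : E), Continuous fun z : ℂ => x' + z • y := fun _ _ => by fun_prop
  have hdiff : ∀ (y : E) (l : G →L[ℂ] ℂ) (z₀ : ℂ), x + z₀ • y ∈ U →
      DifferentiableAt ℂ (fun z : ℂ => l (g (f (x + z • y)))) z₀ := by
    intro y l z₀ hz₀
    obtain ⟨δ, hδ⟩ := hexp _ hz₀
    have hct : Tendsto (fun z : ℂ => l (g (f (x + z₀ • y + z • y)))) (𝓝 0)
        (𝓝 (l (g (f (x + z₀ • y))))) := by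
      have h1 : Tendsto (fun z : ℂ => x + z₀ • y + z • y) (𝓝 0) (𝓝 (x + z₀ • y)) := by
        simpa using (hline (x + z₀ • y) y).tendsto 0
      exact (l.continuous.tendsto _).comp
        ((hcont.continuousAt (hU.mem_nhds hz₀)).tendsto.comp h1)
    have h0 : l (δ 0 fun _ => y) = l (g (f (x + z₀ • y))) := by
      have h1 := (hδ y l 1).trans_tendsto (((continuous_pow 1).tendsto' (0 : ℂ) 0
        (by simp)).mono_left nhdsWithin_le_nhds)
      have h2 := (hct.mono_left (nhdsWithin_le_nhds (s := {0}ᶜ))).sub_const (l (δ 0 fun _ => y))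
      have h3 := tendsto_nhds_unique h2 (h1.congr fun z => by simp)
      exact (sub_eq_zero.1 h3).symm
    suffices HasDerivAt (fun z : ℂ => l (g (f (x + z • y)))) (l (δ 1 fun _ => y)) z₀ from
      this.differentiableAt
    rw [hasDerivAt_iff_tendsto_slope_zero]
    have h2 : (fun z : ℂ => z⁻¹ • (l (g (f (x + (z₀ + z) • y))) - l (g (f (x + z₀ • y)))) -
        l (δ 1 fun _ => y)) =O[𝓝[≠] 0] fun z => z := by
      obtain ⟨C, hC⟩ := (hδ y l 2).bound
      refine IsBigO.of_bound C ?_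
      filter_upwards [hC, self_mem_nhdsWithin] with z hz hz0
      have hz0' : 0 < ‖z‖ := norm_pos_iff.2 hz0
      refine le_of_mul_le_mul_left ?_ hz0'
      rw [← norm_mul]
      refine le_trans (le_of_eq ?_) (hz.trans (le_of_eq ?_))
      · congr 1
        rw [mul_sub, smul_eq_mul, mul_inv_cancel_left₀ hz0, Finset.sum_range_succ,
          Finset.sum_range_one, h0, add_smul, ← add_assoc]
        ring
      · rw [norm_pow]; ring
    have h3 := h2.trans_tendsto (tendsto_id.mono_left nhdsWithin_le_nhds)
    simpa using h3.add_const (l (δ 1 fun _ => y))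
  obtain ⟨δ, hδ⟩ := hexp x hx
  refine ⟨δ, ?_⟩
  obtain ⟨ρ, hρ, hW⟩ := exists_ball_smul_mem (eventually_add_mem hU hx) (0 : E)
  -- The factor `2 / ρ` turns the disc of radius `ρ` into the disc of radius `2`, which leaves room
  -- for Cauchy estimates around `z = 1`.
  have hsc : Tendsto (fun y : E => ((2 / ρ : ℝ) : ℂ) • y) (𝓝 0) (𝓝 0) := by
    simpa using (continuous_const_smul ((2 / ρ : ℝ) : ℂ)).tendsto (0 : E)
  filter_upwards [hsc.eventually hW] with y hy
  have hy' : ∀ z : ℂ, ‖z‖ < 2 → x + z • y ∈ U := by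
    intro z hz
    have h1 := hy (((ρ / 2 : ℝ) : ℂ) * z) (by
      rw [norm_mul, Complex.norm_real, Real.norm_of_nonneg (by positivity)]
      have := mul_lt_mul_of_pos_left hz (half_pos hρ)
      linarith)
    rw [smul_smul] at h1
    have h2 : ((ρ / 2 : ℝ) : ℂ) * z * ((2 / ρ : ℝ) : ℂ) = z := by
      have : (ρ : ℂ) ≠ 0 := by exact_mod_cast hρ.ne'
      push_cast; field_simp
    rwa [h2] at h1
  have := hasSum_of_weak (h := fun z : ℂ => g (f (x + z • y))) (d := fun n => δ n fun _ => y)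
    (hcont.comp (hline x y).continuousOn fun z hz => hy' z (by simpa using hz))
    (fun l z hz => hasSum_of_asymptotic (ρ := 2) (fun z hz =>
      (hdiff y l z (hy' z (by simpa using hz))).differentiableWithinAt) (hδ y l) hz)
  simpa using this

end Series

/-! ### Complex analytic maps: locality, linear maps, pairs, derivatives. -/

section ComplexAnalytic

open Filter

variable {E F G : Type*}
  [AddCommGroup E] [Module ℂ E] [TopologicalSpace E] [IsTopologicalAddGroup E] [ContinuousSMul ℂ E]
  [AddCommGroup F] [Module ℂ F] [TopologicalSpace F] [IsTopologicalAddGroup F] [ContinuousSMul ℂ F]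
  [AddCommGroup G] [Module ℂ G] [TopologicalSpace G] [IsTopologicalAddGroup G] [ContinuousSMul ℂ G]

theorem HasSeriesAt.congr {f g : E → F} {β : FormalMultilinearSeries ℂ E F} {x : E}
    (h : HasSeriesAt f β x) (hfg : f =ᶠ[𝓝 x] g) : HasSeriesAt g β x := by
  have ht : Tendsto (fun y => x + y) (𝓝 0) (𝓝 x) := by
    simpa using (continuous_const_add x).tendsto (0 : E)
  filter_upwards [h, ht.eventually hfg] with y hy hy'
  rwa [← hy']

theorem IsComplexAnalytic.of_local {U : Set E} (hU : IsOpen U) {f : E → F}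
    (h : ∀ x ∈ U, ∃ V, IsOpen V ∧ x ∈ V ∧ ∃ g, IsComplexAnalytic V g ∧ EqOn f g (U ∩ V)) :
    IsComplexAnalytic U f := by
  rw [isComplexAnalytic_iff hU]
  have h' : ∀ x ∈ U, ∃ g, f =ᶠ[𝓝 x] g ∧ ContinuousAt g x ∧
      ∃ β : FormalMultilinearSeries ℂ E F, HasSeriesAt g β x := by
    intro x hx
    obtain ⟨V, hV, hxV, g, hg, hfg⟩ := h x hx
    exact ⟨g, Filter.eventuallyEq_of_mem ((hU.inter hV).mem_nhds ⟨hx, hxV⟩) hfg,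
      hg.1.continuousAt (hV.mem_nhds hxV), hg.hasSeriesAt hxV⟩
  refine ⟨fun x hx => ?_, fun x hx => ?_⟩
  · obtain ⟨g, hfg, hg, -⟩ := h' x hx
    exact (hg.congr hfg.symm).continuousWithinAt
  · obtain ⟨g, hfg, -, β, hβ⟩ := h' x hx
    exact ⟨β, hβ.congr hfg.symm⟩

theorem IsComplexAnalytic.mono {U V : Set E} (hV : IsOpen V) (hVU : V ⊆ U) {f : E → F}
    (hf : IsComplexAnalytic U f) : IsComplexAnalytic V f := by
  rw [isComplexAnalytic_iff hV]
  exact ⟨hf.1.mono hVU, fun x hx => hf.hasSeriesAt (hVU hx)⟩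

theorem isComplexAnalytic_clm (L : E →L[ℂ] F) {U : Set E} (hU : IsOpen U) :
    IsComplexAnalytic U L := by
  rw [isComplexAnalytic_iff hU]
  refine ⟨L.continuous.continuousOn, fun x _ => ?_⟩
  let β : FormalMultilinearSeries ℂ E F := fun n =>
    match n with
    | 0 => ContinuousMultilinearMap.constOfIsEmpty ℂ _ (L x)
    | 1 => L.compContinuousMultilinearMap (ContinuousMultilinearMap.ofSubsingleton ℂ E E 0
        (ContinuousLinearMap.id ℂ E))
    | _ + 2 => 0
  refine ⟨β, Eventually.of_forall fun y => ?_⟩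
  have : HasSum (fun n => β n fun _ => y) (∑ n ∈ Finset.range 2, β n fun _ => y) := by
    refine hasSum_sum_of_ne_finset_zero fun n hn => ?_
    obtain ⟨m, rfl⟩ : ∃ m, n = m + 2 := ⟨n - 2, by simp at hn; omega⟩
    rfl
  simpa [Finset.sum_range_succ, β] using this

theorem IsComplexAnalytic.prodMk {U : Set E} (hU : IsOpen U) {f : E → F} {g : E → G}
    (hf : IsComplexAnalytic U f) (hg : IsComplexAnalytic U g) :
    IsComplexAnalytic U fun x => (f x, g x) := by
  rw [isComplexAnalytic_iff hU]
  refine ⟨hf.1.prodMk hg.1, fun x hx => ?_⟩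
  obtain ⟨β, hβ⟩ := hf.hasSeriesAt hx
  obtain ⟨γ, hγ⟩ := hg.hasSeriesAt hx
  refine ⟨fun n => (β n).prod (γ n), ?_⟩
  filter_upwards [hβ, hγ] with y h1 h2
  exact h1.prodMk h2

theorem IsComplexAnalytic.exists_hadamardDeriv [PolynormableSpace ℂ F] [T2Space F] {U : Set E}
    (hU : IsOpen U) {f : E → F} (hf : IsComplexAnalytic U f) {x : E} (hx : x ∈ U) :
    ∃ A : E →L[ℂ] F, HasHadamardDeriv ℂ f A x := by
  obtain ⟨β, hβ⟩ := hf.hasSeriesAt hx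
  refine ⟨((ContinuousMultilinearMap.ofSubsingleton ℂ E F (0 : Fin 1)).symm (β 1)), ?_⟩
  exact hβ.hasHadamardDeriv (hf.1.continuousAt (hU.mem_nhds hx))

end ComplexAnalytic

/-! ### Complexifications of real locally convex spaces. -/

namespace Complexification

variable {E F G : Type*} [AddCommGroup E] [Module ℝ E] [TopologicalSpace E]
  [AddCommGroup F] [Module ℝ F] [TopologicalSpace F]
  [AddCommGroup G] [Module ℝ G] [TopologicalSpace G]

instance [IsTopologicalAddGroup E] : IsTopologicalAddGroup (Complexification E) :=
  inferInstanceAs (IsTopologicalAddGroup (E × E))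

instance [T2Space E] : T2Space (Complexification E) := inferInstanceAs (T2Space (E × E))

theorem continuous_fst' : Continuous fun p : Complexification E => p.1 :=
  (continuous_fst : Continuous (Prod.fst : E × E → E))

theorem continuous_snd' : Continuous fun p : Complexification E => p.2 :=
  (continuous_snd : Continuous (Prod.snd : E × E → E))

theorem continuous_mk' {X : Type*} [TopologicalSpace X] {f g : X → E} (hf : Continuous f)
    (hg : Continuous g) : Continuous fun x => ((f x, g x) : Complexification E) :=
  (hf.prodMk hg : Continuous fun x => (f x, g x))

theorem continuous_ofReal : Continuous (ofReal : E → Complexification E) :=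
  continuous_mk' continuous_id continuous_const

instance [IsTopologicalAddGroup E] [ContinuousSMul ℝ E] :
    ContinuousSMul ℂ (Complexification E) where
  continuous_smul := by
    have h1 : Continuous fun p : ℂ × Complexification E => p.2.1 :=
      continuous_fst'.comp continuous_snd
    have h2 : Continuous fun p : ℂ × Complexification E => p.2.2 :=
      continuous_snd'.comp continuous_snd
    have h3 : Continuous fun p : ℂ × Complexification E => p.1.re :=
      Complex.continuous_re.comp continuous_fst
    have h4 : Continuous fun p : ℂ × Complexification E => p.1.im :=
      Complex.continuous_im.comp continuous_fst
    exact continuous_mk' ((h3.smul h1).sub (h4.smul h2)) ((h3.smul h2).add (h4.smul h1))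

theorem smul_fst (z : ℂ) (p : Complexification E) : (z • p).1 = z.re • p.1 - z.im • p.2 := rfl

theorem smul_snd (z : ℂ) (p : Complexification E) : (z • p).2 = z.re • p.2 + z.im • p.1 := rfl

theorem add_fst (p q : Complexification E) : (p + q).1 = p.1 + q.1 := rfl

theorem add_snd (p q : Complexification E) : (p + q).2 = p.2 + q.2 := rfl

theorem ofReal_add (x y : E) : ofReal (x + y) = ofReal x + ofReal y :=
  Prod.ext rfl (add_zero (0 : E)).symm

theorem ofReal_sub (x y : E) : ofReal (x - y) = ofReal x - ofReal y :=
  Prod.ext rfl (sub_zero (0 : E)).symm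

theorem ofReal_smul (t : ℝ) (x : E) : ofReal (t • x) = (t : ℂ) • ofReal x := by
  refine Prod.ext ?_ ?_
  · rw [smul_fst]; simp [ofReal]
  · rw [smul_snd]; simp [ofReal]

open scoped ComplexOrder in
instance [IsTopologicalAddGroup E] [ContinuousSMul ℝ E] [PolynormableSpace ℝ E] :
    PolynormableSpace ℂ (Complexification E) := by
  have : LocallyConvexSpace ℂ (Complexification E) := by
    refine LocallyConvexSpace.ofBasisZero ℂ (Complexification E)
      (fun s : Set E => (s ×ˢ s : Set (E × E))) (fun s => s ∈ 𝓝 (0 : E) ∧ Convex ℝ s) ?_ ?_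
    · have h := LocallyConvexSpace.convex_basis_zero ℝ E
      have h2 := h.prod_self
      rw [← nhds_prod_eq] at h2
      exact h2
    · rintro s ⟨-, hs⟩ x hx y hy a b ha hb hab
      obtain ⟨a', ha', rfl⟩ := RCLike.nonneg_iff_exists_ofReal.1 ha
      obtain ⟨b', hb', rfl⟩ := RCLike.nonneg_iff_exists_ofReal.1 hb
      have hab' : a' + b' = 1 := Complex.ofReal_injective (by simpa using hab)
      constructor
      · have := hs hx.1 hy.1 ha' hb' hab'
        rw [add_fst, smul_fst, smul_fst]
        simpa using this
      · have := hs hx.2 hy.2 ha' hb' hab'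
        rw [add_snd, smul_snd, smul_snd]
        simpa using this
  have : ContinuousSMul ℝ (Complexification E) :=
    ⟨(Complex.continuous_ofReal.comp continuous_fst).smul continuous_snd⟩
  exact LocallyConvexSpace.toPolynormableSpace

/-- The complexification of a continuous linear map. -/
def map (L : E →L[ℝ] F) : Complexification E →L[ℂ] Complexification F where
  toFun p := (L p.1, L p.2)
  map_add' p q := Prod.ext (L.map_add p.1 q.1) (L.map_add p.2 q.2)
  map_smul' z p := by
    refine Prod.ext ?_ ?_
    · change L (z.re • p.1 - z.im • p.2) = z.re • L p.1 - z.im • L p.2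
      simp
    · change L (z.re • p.2 + z.im • p.1) = z.re • L p.2 + z.im • L p.1
      simp
  cont := continuous_mk' (L.continuous.comp continuous_fst') (L.continuous.comp continuous_snd')

theorem map_ofReal (L : E →L[ℝ] F) (x : E) : map L (ofReal x) = ofReal (L x) :=
  Prod.ext rfl L.map_zero

/-- The complexification of a product. -/
def ofProd : Complexification F × Complexification G →L[ℂ] Complexification (F × G) where
  toFun p := ((p.1.1, p.2.1), (p.1.2, p.2.2))
  map_add' _ _ := rfl
  map_smul' _ _ := rfl
  cont := continuous_mk'
    ((continuous_fst'.comp continuous_fst).prodMk (continuous_fst'.comp continuous_snd))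
    ((continuous_snd'.comp continuous_fst).prodMk (continuous_snd'.comp continuous_snd))

end Complexification

open Filter Complexification

theorem HasHadamardDeriv.hasDerivAt_line {𝕜 : Type*} [RCLike 𝕜] {E F : Type*} [AddCommGroup E]
    [Module 𝕜 E] [TopologicalSpace E] [AddCommGroup F] [Module 𝕜 F] [TopologicalSpace F]
    {f A : E → F} {x y : E} {z : 𝕜} (h : HasHadamardDeriv 𝕜 f A (x + z • y)) (l : F →L[𝕜] 𝕜) :
    HasDerivAt (fun z : 𝕜 => l (f (x + z • y))) (l (A y)) z := by
  rw [hasDerivAt_iff_tendsto_slope_zero]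
  have hline : Tendsto (fun z : 𝕜 => (y, z)) (𝓝[≠] 0) (𝓝 y ×ˢ 𝓝[≠] 0) :=
    tendsto_const_nhds.prodMk tendsto_id
  refine ((l.continuous.tendsto _).comp ((h y).comp hline)).congr fun t => ?_
  simp [add_smul, add_assoc]

/-! ### Real analytic maps. -/

section RealAnalytic

variable {E F G : Type*}
  [AddCommGroup E] [Module ℝ E] [TopologicalSpace E] [IsTopologicalAddGroup E] [ContinuousSMul ℝ E]
  [AddCommGroup F] [Module ℝ F] [TopologicalSpace F] [IsTopologicalAddGroup F] [ContinuousSMul ℝ F]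
  [AddCommGroup G] [Module ℝ G] [TopologicalSpace G] [IsTopologicalAddGroup G] [ContinuousSMul ℝ G]

theorem IsRealAnalytic.continuousOn {U : Set E} {f : E → F} (hf : IsRealAnalytic U f) :
    ContinuousOn f U := by
  obtain ⟨W, g, -, hg, h⟩ := hf
  have h1 : ContinuousOn (fun x => (g (ofReal x)).1) U :=
    continuous_fst'.comp_continuousOn
      (hg.1.comp continuous_ofReal.continuousOn fun x hx => (h x hx).1)
  refine h1.congr fun x hx => ?_
  change f x = (g (ofReal x)).1
  rw [(h x hx).2]; rfl

theorem IsRealAnalytic.mono {U V : Set E} (hVU : V ⊆ U) {f : E → F}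
    (hf : IsRealAnalytic U f) : IsRealAnalytic V f := by
  obtain ⟨W, g, hW, hg, h⟩ := hf
  exact ⟨W, g, hW, hg, fun x hx => h x (hVU hx)⟩

theorem IsRealAnalytic.congr {U : Set E} {f g : E → F} (hf : IsRealAnalytic U f)
    (hfg : EqOn f g U) : IsRealAnalytic U g := by
  obtain ⟨W, k, hW, hk, h⟩ := hf
  exact ⟨W, k, hW, hk, fun x hx => ⟨(h x hx).1, by rw [(h x hx).2, hfg hx]⟩⟩

theorem isRealAnalytic_clm (L : E →L[ℝ] F) (U : Set E) : IsRealAnalytic U L :=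
  ⟨univ, map L, isOpen_univ, isComplexAnalytic_clm _ isOpen_univ,
    fun x _ => ⟨mem_univ _, map_ofReal L x⟩⟩

theorem IsRealAnalytic.comp [PolynormableSpace ℝ F] [T2Space F] [PolynormableSpace ℝ G]
    [T2Space G] {U : Set E} {V : Set F} {f : E → F} {g : F → G}
    (hg : IsRealAnalytic V g) (hf : IsRealAnalytic U f) (hUV : MapsTo f U V) :
    IsRealAnalytic U (g ∘ f) := by
  obtain ⟨W, k, hW, hk, h⟩ := hf
  obtain ⟨W', k', hW', hk', h'⟩ := hg
  have hO : IsOpen (W ∩ k ⁻¹' W') := hk.1.isOpen_inter_preimage hW hW'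
  refine ⟨W ∩ k ⁻¹' W', k' ∘ k, hO,
    hk'.comp hO hW' (hk.mono hO inter_subset_left) fun x hx => hx.2, fun x hx => ⟨⟨(h x hx).1, ?_⟩, ?_⟩⟩
  · rw [mem_preimage, (h x hx).2]
    exact (h' _ (hUV hx)).1
  · rw [Function.comp_apply, (h x hx).2, (h' _ (hUV hx)).2]
    rfl

theorem IsRealAnalytic.prodMk [PolynormableSpace ℝ F] [T2Space F] [PolynormableSpace ℝ G]
    [T2Space G] {U : Set E} {f : E → F} {g : E → G}
    (hf : IsRealAnalytic U f) (hg : IsRealAnalytic U g) :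
    IsRealAnalytic U fun x => (f x, g x) := by
  obtain ⟨W, k, hW, hk, h⟩ := hf
  obtain ⟨W', k', hW', hk', h'⟩ := hg
  have hO := hW.inter hW'
  refine ⟨W ∩ W', ofProd ∘ fun p => (k p, k' p), hO,
    (isComplexAnalytic_clm ofProd isOpen_univ).comp hO isOpen_univ
      ((hk.mono hO inter_subset_left).prodMk hO (hk'.mono hO inter_subset_right))
      (mapsTo_univ _ _), fun x hx => ⟨⟨(h x hx).1, (h' x hx).1⟩, ?_⟩⟩
  rw [Function.comp_apply, (h x hx).2, (h' x hx).2]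
  rfl

/-- The derivative is the real part of the derivative of a complex extension, restricted to real
directions. -/
theorem IsRealAnalytic.exists_hadamardDeriv [PolynormableSpace ℝ F] [T2Space F] {U : Set E}
    (hU : IsOpen U) {f : E → F} (hf : IsRealAnalytic U f) {x : E} (hx : x ∈ U) :
    ∃ A : E →L[ℝ] F, HasHadamardDeriv ℝ f A x := by
  obtain ⟨W, k, hW, hk, h⟩ := hf
  obtain ⟨A, hA⟩ := hk.exists_hadamardDeriv hW (h x hx).1
  refine ⟨{ toFun := fun y => (A (ofReal y)).1
            map_add' := fun y y' => by rw [ofReal_add, map_add]; rfl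
            map_smul' := fun t y => by rw [ofReal_smul, map_smul, smul_fst]; simp
            cont := continuous_fst'.comp (A.continuous.comp continuous_ofReal) }, fun y => ?_⟩
  have h1 : Tendsto (fun p : E × ℝ => (ofReal p.1, (p.2 : ℂ))) (𝓝 y ×ˢ 𝓝[≠] 0)
      (𝓝 (ofReal y) ×ˢ 𝓝[≠] 0) := by
    refine ((continuous_ofReal.tendsto y).comp tendsto_fst).prodMk ?_
    refine Tendsto.comp (g := fun t : ℝ => (t : ℂ)) (y := 𝓝[≠] 0) ?_ tendsto_snd
    refine tendsto_nhdsWithin_iff.2 ⟨?_, ?_⟩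
    · exact (Complex.continuous_ofReal.tendsto' 0 0 (by simp)).mono_left nhdsWithin_le_nhds
    · filter_upwards [self_mem_nhdsWithin] with t ht
      simpa using ht
  refine ((continuous_fst'.tendsto _).comp ((hA (ofReal y)).comp h1)).congr' ?_
  have h2 : ∀ᶠ p : E × ℝ in 𝓝 y ×ˢ 𝓝[≠] 0, x + p.2 • p.1 ∈ U := by
    have hc : Continuous fun p : E × ℝ => x + p.2 • p.1 := by fun_prop
    have := (hc.tendsto (y, (0 : ℝ))).eventually (hU.mem_nhds (by simpa using hx))
    rw [nhds_prod_eq] at this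
    exact (prod_mono le_rfl nhdsWithin_le_nhds : 𝓝 y ×ˢ 𝓝[≠] (0 : ℝ) ≤ _) this
  filter_upwards [h2] with p hp
  change (((p.2 : ℂ)⁻¹ • (k (ofReal x + (p.2 : ℂ) • ofReal p.1) - k (ofReal x)))).1 = _
  rw [← ofReal_smul, ← ofReal_add, (h _ hp).2, (h x hx).2, ← ofReal_sub, ← Complex.ofReal_inv,
    ← ofReal_smul]
  rfl

/-- The box `(x + C) + i C` in the complexification. -/
def box (x : E) (C : Set E) : Set (Complexification E) := {w | w.1 - x ∈ C ∧ w.2 ∈ C}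

theorem isOpen_box (x : E) {C : Set E} (hC : IsOpen C) : IsOpen (box x C) :=
  (hC.preimage (continuous_fst'.sub continuous_const)).inter (hC.preimage continuous_snd')

/-- Identity theorem for complex analytic maps that agree on the real points of the intersection
of two boxes. -/
theorem eq_of_mem_box [PolynormableSpace ℝ F] [T2Space F] {x x' : E} {C C' : Set E}
    (hC : IsOpen C) (hC' : IsOpen C') (hcC : Convex ℝ C) (hcC' : Convex ℝ C') (h0 : (0 : E) ∈ C)
    (h0' : (0 : E) ∈ C') {g g' : Complexification E → Complexification F}
    (hg : IsComplexAnalytic (box x C) g) (hg' : IsComplexAnalytic (box x' C') g')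
    (heq : ∀ a : E, ofReal a ∈ box x C → ofReal a ∈ box x' C' → g (ofReal a) = g' (ofReal a))
    {w : Complexification E} (hw : w ∈ box x C) (hw' : w ∈ box x' C') : g w = g' w := by
  refine eq_of_forall_dual_eq (𝕜 := ℂ) fun l => ?_
  -- This complex line meets the real points exactly where needed: real `z` gives real points, and
  -- `z = i` gives `w`. The claim becomes the identity theorem in one variable.
  set γ : ℂ → Complexification E := fun z => ofReal w.1 + z • ofReal w.2 with hγ
  have hγ1 : ∀ z, (γ z).1 = w.1 + z.re • w.2 := fun z => by
    change w.1 + (z.re • w.2 - z.im • (0 : E)) = _; simp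
  have hγ2 : ∀ z, (γ z).2 = z.im • w.2 := fun z => by
    change (0 : E) + (z.re • (0 : E) + z.im • w.2) = _; simp
  have hγI : γ Complex.I = w := Prod.ext (by rw [hγ1]; simp) (by rw [hγ2]; simp)
  have hγr : ∀ t : ℝ, γ t = ofReal (w.1 + t • w.2) := fun t => by
    rw [ofReal_add, ofReal_smul]
  have hγc : Continuous γ := by simp only [hγ]; fun_prop
  have hconv : ∀ (x : E) (C : Set E), Convex ℝ C → Convex ℝ (γ ⁻¹' box x C) := by
    intro x C hc z hz z' hz' a b ha hb hab
    constructor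
    · have := hc hz.1 hz'.1 ha hb hab
      rw [hγ1, hγ1] at this
      rw [hγ1]
      convert this using 1
      have hx : w.1 - x = (a + b) • (w.1 - x) := by rw [hab, one_smul]
      have h2 : w.1 + (a • z + b • z').re • w.2 - x =
          (w.1 - x) + (a * z.re + b * z'.re) • w.2 := by
        simp; abel
      rw [h2, hx]
      module
    · have := hc hz.2 hz'.2 ha hb hab
      rw [hγ2, hγ2] at this
      rw [hγ2]
      convert this using 1
      simp [add_smul, mul_smul]
  set Ω : Set ℂ := γ ⁻¹' box x C ∩ γ ⁻¹' box x' C' with hΩ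
  have hΩo : IsOpen Ω := ((isOpen_box x hC).preimage hγc).inter ((isOpen_box x' hC').preimage hγc)
  -- Convex boxes are used because convexity, unlike connectedness, survives intersection.
  have hΩc : IsPreconnected Ω := ((hconv x C hcC).inter (hconv x' C' hcC')).isPreconnected
  have hstar : ∀ (x : E) (C : Set E), (0 : E) ∈ C → w ∈ box x C → (0 : ℂ) ∈ γ ⁻¹' box x C := by
    intro x C h0 hw
    exact ⟨by rw [hγ1]; simpa using hw.1, by rw [hγ2]; simpa using h0⟩
  have h0Ω : (0 : ℂ) ∈ Ω := ⟨hstar x C h0 hw, hstar x' C' h0' hw'⟩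
  have hIΩ : Complex.I ∈ Ω := ⟨by rwa [mem_preimage, hγI], by rwa [mem_preimage, hγI]⟩
  have hdiff : ∀ (x : E) (C : Set E) (g : Complexification E → Complexification F), IsOpen C →
      IsComplexAnalytic (box x C) g → ∀ z ∈ γ ⁻¹' box x C,
      DifferentiableAt ℂ (fun z => l (g (γ z))) z := by
    intro x C g hC hg z hz
    obtain ⟨A, hA⟩ := hg.exists_hadamardDeriv (isOpen_box x hC) hz
    exact (HasHadamardDeriv.hasDerivAt_line hA l).differentiableAt
  have han : AnalyticOnNhd ℂ (fun z => l (g (γ z)) - l (g' (γ z))) Ω := by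
    refine DifferentiableOn.analyticOnNhd (fun z hz => ?_) hΩo
    exact ((hdiff x C g hC hg z hz.1).sub (hdiff x' C' g' hC' hg' z hz.2)).differentiableWithinAt
  have hfreq : ∃ᶠ z in 𝓝[≠] (0 : ℂ), l (g (γ z)) - l (g' (γ z)) = 0 := by
    have ht : Tendsto (fun t : ℝ => (t : ℂ)) (𝓝[≠] 0) (𝓝[≠] 0) := by
      refine tendsto_nhdsWithin_iff.2 ⟨?_, ?_⟩
      · exact (Complex.continuous_ofReal.tendsto' 0 0 (by simp)).mono_left nhdsWithin_le_nhds
      · filter_upwards [self_mem_nhdsWithin] with t ht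
        simpa using ht
    refine ht.frequently (Eventually.frequently ?_)
    have hev : ∀ᶠ t : ℝ in 𝓝[≠] 0, (t : ℂ) ∈ Ω :=
      ht.eventually (mem_nhdsWithin_of_mem_nhds (hΩo.mem_nhds h0Ω))
    filter_upwards [hev] with t ht
    have h1 := ht.1
    have h2 := ht.2
    rw [mem_preimage, hγr] at h1 h2
    rw [hγr, heq _ h1 h2, sub_self]
  have := han.eqOn_zero_of_preconnected_of_frequently_eq_zero hΩc h0Ω hfreq hIΩ
  simpa [hγI, sub_eq_zero] using this

/-- The definition asks for one extension near all of `U`, so local extensions have to be glued. On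
convex boxes they agree on overlaps by `eq_of_mem_box`. -/
theorem IsRealAnalytic.of_local [PolynormableSpace ℝ E] [PolynormableSpace ℝ F] [T2Space F]
    {U : Set E} (hU : IsOpen U) {f : E → F}
    (h : ∀ x ∈ U, ∃ V, IsOpen V ∧ x ∈ V ∧ IsRealAnalytic (U ∩ V) f) : IsRealAnalytic U f := by
  classical
  have key : ∀ x : U, ∃ (C : Set E) (g : Complexification E → Complexification F),
      IsOpen C ∧ Convex ℝ C ∧ (0 : E) ∈ C ∧ IsComplexAnalytic (box (x : E) C) g ∧
      ∀ a, ofReal a ∈ box (x : E) C → g (ofReal a) = ofReal (f a) := by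
    rintro ⟨x, hx⟩
    obtain ⟨V, hV, hxV, W, g, hW, hg, hfg⟩ := h x hx
    have h1 : ∀ᶠ p : E × E in 𝓝 (0 : E) ×ˢ 𝓝 (0 : E),
        ((x + p.1, p.2) : Complexification E) ∈ W ∧ x + p.1 ∈ U ∩ V := by
      rw [← nhds_prod_eq]
      refine Eventually.and ?_ ?_
      · have hc : Continuous fun p : E × E => ((x + p.1, p.2) : Complexification E) :=
          continuous_mk' (by fun_prop) (by fun_prop)
        refine (hc.tendsto 0).eventually (hW.mem_nhds ?_)
        have := (hfg x ⟨hx, hxV⟩).1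
        simpa [ofReal] using this
      · have hc : Continuous fun p : E × E => x + p.1 := by fun_prop
        exact (hc.tendsto 0).eventually ((hU.inter hV).mem_nhds (by simpa using ⟨hx, hxV⟩))
    obtain ⟨C, ⟨h0, hCo, hCc⟩, hC⟩ :=
      ((LocallyConvexSpace.convex_open_basis_zero ℝ E).prod_self).eventually_iff.1 h1
    have hbox : ∀ w ∈ box x C, w ∈ W ∧ w.1 ∈ U ∩ V := by
      intro w hw
      have := @hC (w.1 - x, w.2) ⟨hw.1, hw.2⟩
      simp only [add_sub_cancel] at this
      exact this
    exact ⟨C, g, hCo, hCc, h0, hg.mono (isOpen_box x hCo) fun w hw => (hbox w hw).1,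
      fun a ha => (hfg a (hbox _ ha).2).2⟩
  choose C g hCo hCc h0 hg hfg using key
  have hcompat : ∀ (x x' : U) (w : Complexification E), w ∈ box (x : E) (C x) →
      w ∈ box (x' : E) (C x') → g x w = g x' w := fun x x' w hw hw' =>
    eq_of_mem_box (hCo x) (hCo x') (hCc x) (hCc x') (h0 x) (h0 x') (hg x) (hg x')
      (fun a ha ha' => by rw [hfg x a ha, hfg x' a ha']) hw hw'
  set W : Set (Complexification E) := ⋃ x : U, box (x : E) (C x) with hW
  set G : Complexification E → Complexification F := fun w =>
    if hw : ∃ x : U, w ∈ box (x : E) (C x) then g hw.choose w else 0 with hG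
  have hGg : ∀ (x : U) (w : Complexification E), w ∈ box (x : E) (C x) → G w = g x w := by
    intro x w hw
    have hex : ∃ x : U, w ∈ box (x : E) (C x) := ⟨x, hw⟩
    simp only [hG, dif_pos hex]
    exact hcompat _ _ _ hex.choose_spec hw
  have hWo : IsOpen W := isOpen_iUnion fun x => isOpen_box _ (hCo x)
  have hself : ∀ x : U, ofReal (x : E) ∈ box (x : E) (C x) := fun x =>
    ⟨by simpa [ofReal] using h0 x, h0 x⟩
  refine ⟨W, G, hWo, IsComplexAnalytic.of_local hWo fun w hw => ?_, fun x hx => ⟨?_, ?_⟩⟩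
  · obtain ⟨x, hx⟩ := mem_iUnion.1 hw
    exact ⟨_, isOpen_box _ (hCo x), hx, g x, hg x, fun w' hw' => hGg x w' hw'.2⟩
  · exact mem_iUnion.2 ⟨⟨x, hx⟩, hself ⟨x, hx⟩⟩
  · rw [hGg ⟨x, hx⟩ _ (hself ⟨x, hx⟩), hfg _ _ (hself ⟨x, hx⟩)]

end RealAnalytic

universe u v w

open Filter

/-- The limit in a Hadamard derivative allows the direction to vary; the difference quotients of
`f`, which tend to `A y`, serve as directions for `g`. -/
theorem HasHadamardDeriv.comp {𝕜 : Type*} [RCLike 𝕜] {E F G : Type*}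
    [AddCommGroup E] [Module 𝕜 E] [TopologicalSpace E] [AddCommGroup F] [Module 𝕜 F]
    [TopologicalSpace F] [AddCommGroup G] [Module 𝕜 G] [TopologicalSpace G]
    {g B : F → G} {f A : E → F} {x : E} (hg : HasHadamardDeriv 𝕜 g B (f x))
    (hf : HasHadamardDeriv 𝕜 f A x) : HasHadamardDeriv 𝕜 (g ∘ f) (B ∘ A) x := by
  intro y
  have h1 : Tendsto (fun p : E × 𝕜 => (p.2⁻¹ • (f (x + p.2 • p.1) - f x), p.2))
      (𝓝 y ×ˢ 𝓝[≠] 0) (𝓝 (A y) ×ˢ 𝓝[≠] 0) := (hf y).prodMk tendsto_snd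
  have hne : ∀ᶠ p : E × 𝕜 in 𝓝 y ×ˢ 𝓝[≠] 0, p.2 ≠ 0 := tendsto_snd.eventually self_mem_nhdsWithin
  refine ((hg (A y)).comp h1).congr' ?_
  filter_upwards [hne] with p hp
  simp only [Function.comp_apply, smul_inv_smul₀ hp, add_sub_cancel]

theorem HasHadamardDeriv.congr {𝕜 : Type*} [RCLike 𝕜] {E F : Type*}
    [AddCommGroup E] [Module 𝕜 E] [TopologicalSpace E] [ContinuousAdd E] [ContinuousSMul 𝕜 E]
    [AddCommGroup F] [Module 𝕜 F] [TopologicalSpace F]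
    {f g A : E → F} {x : E} (hf : HasHadamardDeriv 𝕜 f A x) (hfg : f =ᶠ[𝓝 x] g) :
    HasHadamardDeriv 𝕜 g A x := by
  intro y
  have hc : Continuous fun p : E × 𝕜 => x + p.2 • p.1 := by fun_prop
  have h1 : ∀ᶠ p : E × 𝕜 in 𝓝 y ×ˢ 𝓝[≠] 0, f (x + p.2 • p.1) = g (x + p.2 • p.1) := by
    have h2 : Tendsto (fun p : E × 𝕜 => x + p.2 • p.1) (𝓝 y ×ˢ 𝓝 0) (𝓝 x) := by
      rw [← nhds_prod_eq]
      exact hc.tendsto' _ _ (by simp)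
    exact (h2.mono_left (prod_mono le_rfl nhdsWithin_le_nhds)).eventually hfg
  refine (hf y).congr' ?_
  filter_upwards [h1] with p hp
  rw [hp, hfg.self_of_nhds]

/-! ### Michal-Bastiani calculus. -/

section Ck

variable {E : Type u} {F : Type v} {G : Type w}
  [AddCommGroup E] [Module ℝ E] [TopologicalSpace E] [IsTopologicalAddGroup E] [ContinuousSMul ℝ E]
  [AddCommGroup F] [Module ℝ F] [TopologicalSpace F] [IsTopologicalAddGroup F] [ContinuousSMul ℝ F]
  [AddCommGroup G] [Module ℝ G] [TopologicalSpace G] [IsTopologicalAddGroup G] [ContinuousSMul ℝ G]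

theorem IsCk.continuousOn {k : ℕ} {U : Set E} {f : E → F} (hf : IsCk k U f) :
    ContinuousOn f U := by
  cases k with
  | zero => exact hf
  | succ k => exact hf.1

omit [IsTopologicalAddGroup E] [ContinuousSMul ℝ E] [IsTopologicalAddGroup F]
  [ContinuousSMul ℝ F] in
theorem IsCk.of_succ {k : ℕ} {U : Set E} {f : E → F} (hf : IsCk (k + 1) U f) : IsCk k U f := by
  induction k generalizing E with
  | zero => exact hf.1
  | succ k ih =>
    obtain ⟨hc, df, hd, hdf⟩ := hf
    exact ⟨hc, df, hd, ih hdf⟩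

omit [IsTopologicalAddGroup E] [ContinuousSMul ℝ E] [IsTopologicalAddGroup F]
  [ContinuousSMul ℝ F] in
theorem IsCk.mono {k : ℕ} {U V : Set E} (hVU : V ⊆ U) {f : E → F} (hf : IsCk k U f) :
    IsCk k V f := by
  induction k generalizing E with
  | zero => exact ContinuousOn.mono hf hVU
  | succ k ih =>
    obtain ⟨hc, df, hd, hdf⟩ := hf
    exact ⟨hc.mono hVU, df, fun x hx => hd x (hVU hx), ih (prod_mono hVU subset_rfl) hdf⟩

theorem eventually_add_smul_mem {U : Set E} (hU : IsOpen U) {x : E} (hx : x ∈ U) (y : E) :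
    ∀ᶠ t : ℝ in 𝓝[≠] 0, x + t • y ∈ U := by
  have hc : Continuous fun t : ℝ => x + t • y := by fun_prop
  exact ((hc.tendsto' 0 x (by simp)).mono_left nhdsWithin_le_nhds).eventually (hU.mem_nhds hx)

theorem IsCk.congr {k : ℕ} {U : Set E} (hU : IsOpen U) {f g : E → F} (hf : IsCk k U f)
    (hfg : EqOn f g U) : IsCk k U g := by
  cases k with
  | zero => exact ContinuousOn.congr hf hfg.symm
  | succ k =>
    obtain ⟨hc, df, hd, hdf⟩ := hf
    refine ⟨hc.congr hfg.symm, df, fun x hx y => (hd x hx y).congr' ?_, hdf⟩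
    filter_upwards [eventually_add_smul_mem hU hx y] with t ht
    rw [hfg ht, hfg hx]

omit [IsTopologicalAddGroup E] [ContinuousSMul ℝ E] [IsTopologicalAddGroup F]
  [ContinuousSMul ℝ F] in
theorem isCk_clm (k : ℕ) (L : E →L[ℝ] F) (U : Set E) : IsCk k U L := by
  induction k generalizing E with
  | zero => exact L.continuous.continuousOn
  | succ k ih =>
    refine ⟨L.continuous.continuousOn, L.comp (ContinuousLinearMap.snd ℝ E E), fun x _ y => ?_,
      ih _ _⟩
    refine tendsto_const_nhds.congr' ?_
    filter_upwards [self_mem_nhdsWithin] with t ht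
    have ht : t ≠ 0 := ht
    simp [ht]

omit [IsTopologicalAddGroup E] [ContinuousSMul ℝ E] [IsTopologicalAddGroup F]
  [ContinuousSMul ℝ F] in
theorem IsCk.comp_clm {k : ℕ} {D : Type u} [AddCommGroup D] [Module ℝ D] [TopologicalSpace D]
    {U : Set E} {f : E → F} (hf : IsCk k U f) (L : D →L[ℝ] E) : IsCk k (L ⁻¹' U) (f ∘ L) := by
  induction k generalizing D E with
  | zero => exact ContinuousOn.comp hf L.continuous.continuousOn fun x hx => hx
  | succ k ih =>
    obtain ⟨hc, df, hd, hdf⟩ := hf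
    refine ⟨hc.comp L.continuous.continuousOn fun x hx => hx, df ∘ (L.prodMap L), fun x hx y => ?_, ?_⟩
    · simpa using hd (L x) hx (L y)
    · have h := ih hdf (L.prodMap L)
      have he : (L.prodMap L) ⁻¹' (U ×ˢ univ) = (L ⁻¹' U) ×ˢ univ := by ext p; simp
      rwa [he] at h

omit [IsTopologicalAddGroup E] [ContinuousSMul ℝ E] [IsTopologicalAddGroup F]
  [ContinuousSMul ℝ F] [IsTopologicalAddGroup G] [ContinuousSMul ℝ G] in
theorem IsCk.prodMk {k : ℕ} {U : Set E} {f : E → F} {g : E → G} (hf : IsCk k U f)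
    (hg : IsCk k U g) : IsCk k U fun x => (f x, g x) := by
  induction k generalizing E with
  | zero => exact ContinuousOn.prodMk hf hg
  | succ k ih =>
    obtain ⟨hc, df, hd, hdf⟩ := hf
    obtain ⟨hc', dg, hd', hdg⟩ := hg
    exact ⟨hc.prodMk hc', fun p => (df p, dg p), fun x hx y => (hd x hx y).prodMk_nhds (hd' x hx y),
      ih hdf hdg⟩

/-- Mean value theorem: difference quotients converge locally uniformly to a continuous
directional derivative. -/
theorem tendsto_differenceQuotient [PolynormableSpace ℝ F] {U : Set E} (hU : IsOpen U)
    {f : E → F} {df : E × E → F}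
    (hd : ∀ x ∈ U, ∀ y, Tendsto (fun t : ℝ => t⁻¹ • (f (x + t • y) - f x)) (𝓝[≠] 0)
      (𝓝 (df (x, y))))
    (hc : ContinuousOn df (U ×ˢ univ)) {x : E} (hx : x ∈ U) (y : E) :
    Tendsto (fun p : (E × E) × ℝ => p.2⁻¹ • (f (p.1.1 + p.2 • p.1.2) - f p.1.1))
      (𝓝 (x, y) ×ˢ 𝓝[≠] 0) (𝓝 (df (x, y))) := by
  rw [tendsto_iff_seminorm (𝕜 := ℝ)]
  intro q hq ε hε
  have hev : ∀ᶠ p : (E × E) × ℝ in 𝓝 (x, y) ×ˢ 𝓝 0, p.1.1 + p.2 • p.1.2 ∈ U ∧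
      q (df (p.1.1 + p.2 • p.1.2, p.1.2) - df (x, y)) < ε / 2 := by
    have hcm : Continuous fun p : (E × E) × ℝ => (p.1.1 + p.2 • p.1.2, p.1.2) := by fun_prop
    have ht : Tendsto (fun p : (E × E) × ℝ => (p.1.1 + p.2 • p.1.2, p.1.2))
        (𝓝 (x, y) ×ˢ 𝓝 0) (𝓝 (x, y)) := by
      rw [← nhds_prod_eq]
      exact hcm.tendsto' _ _ (by simp)
    have hUy : U ×ˢ (univ : Set E) ∈ 𝓝 (x, y) := (hU.prod isOpen_univ).mem_nhds ⟨hx, mem_univ y⟩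
    refine (ht.eventually (eventually_mem_set.2 hUy)).mono (fun p hp => hp.1) |>.and ?_
    exact (tendsto_iff_seminorm.1 ((hc.continuousAt hUy).tendsto.comp ht)) q hq _ (half_pos hε)
  obtain ⟨W, hW, D, hD, hWD⟩ := mem_prod_iff.1 hev
  obtain ⟨δ, hδ, hδD⟩ := Metric.mem_nhds_iff.1 hD
  have hball : Metric.ball (0 : ℝ) δ \ {0} ∈ 𝓝[≠] (0 : ℝ) :=
    sdiff_mem_nhdsWithin_compl (Metric.ball_mem_nhds _ hδ) _
  filter_upwards [prod_mem_prod hW hball] with p hp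
  obtain ⟨hpW, hpδ, hp0⟩ := hp
  have hp0 : p.2 ≠ 0 := hp0
  have hgood : ∀ r ∈ Metric.ball (0 : ℝ) δ, p.1.1 + r • p.1.2 ∈ U ∧
      q (df (p.1.1 + r • p.1.2, p.1.2) - df (x, y)) < ε / 2 := fun r hr =>
    hWD (mk_mem_prod hpW (hδD hr))
  refine lt_of_le_of_lt ?_ (half_lt_self hε)
  refine seminorm_le_of_forall_dual hq fun l hl => ?_
  -- Subtracting the linear function `r * l (df (x, y))` leaves a function whose derivative is at
  -- most `ε / 2` on the whole interval.
  have hder : ∀ r ∈ Metric.ball (0 : ℝ) δ,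
      HasDerivWithinAt (fun r : ℝ => l (f (p.1.1 + r • p.1.2)) - r * l (df (x, y)))
        (l (df (p.1.1 + r • p.1.2, p.1.2)) - 1 * l (df (x, y))) (Metric.ball 0 δ) r := by
    intro r hr
    refine (HasDerivAt.sub ?_ ((hasDerivAt_id r).mul_const _)).hasDerivWithinAt
    rw [hasDerivAt_iff_tendsto_slope_zero]
    refine ((l.continuous.tendsto _).comp (hd _ (hgood r hr).1 p.1.2)).congr fun t => ?_
    simp [add_smul, add_assoc]
  have hmv := (convex_ball (0 : ℝ) δ).norm_image_sub_le_of_norm_hasDerivWithin_le (C := ε / 2) hder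
    (fun r hr => by
      rw [one_mul, ← map_sub]
      exact (hl _).trans (hgood r hr).2.le) (Metric.mem_ball_self hδ) hpδ
  simp only [zero_smul, add_zero, zero_mul, sub_zero] at hmv
  have hp0' : 0 < ‖p.2‖ := norm_pos_iff.2 hp0
  refine le_of_mul_le_mul_left ?_ hp0'
  rw [← norm_mul, mul_comm ‖p.2‖]
  refine le_trans (le_of_eq ?_) hmv
  congr 1
  rw [map_sub, map_smul, map_sub, smul_eq_mul, mul_sub, mul_inv_cancel_left₀ hp0]
  ring

theorem IsCk.hasHadamardDeriv [PolynormableSpace ℝ F] {U : Set E} (hU : IsOpen U)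
    {f : E → F} {df : E × E → F}
    (hd : ∀ x ∈ U, ∀ y, Tendsto (fun t : ℝ => t⁻¹ • (f (x + t • y) - f x)) (𝓝[≠] 0)
      (𝓝 (df (x, y))))
    (hc : ContinuousOn df (U ×ˢ univ)) {x : E} (hx : x ∈ U) :
    HasHadamardDeriv ℝ f (fun y => df (x, y)) x := by
  intro y
  have h1 : Tendsto (fun p : E × ℝ => ((x, p.1), p.2)) (𝓝 y ×ˢ 𝓝[≠] 0)
      (𝓝 (x, y) ×ˢ 𝓝[≠] 0) := by
    refine Tendsto.prodMk ?_ tendsto_snd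
    rw [nhds_prod_eq]
    exact tendsto_const_nhds.prodMk tendsto_fst
  exact (tendsto_differenceQuotient hU hd hc hx y).comp h1

/-- Additivity comes from the path `x → x + t • y → x + t • y + t • z`: the quotient of the second
leg has a moving base point and converges by `tendsto_differenceQuotient`. -/
theorem IsCk.exists_hadamardDeriv [PolynormableSpace ℝ F] [T2Space F] {k : ℕ} {U : Set E}
    (hU : IsOpen U) {f : E → F} (hf : IsCk (k + 1) U f) {x : E} (hx : x ∈ U) :
    ∃ A : E →L[ℝ] F, HasHadamardDeriv ℝ f A x := by
  obtain ⟨-, df, hd, hdf⟩ := hf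
  have hc := hdf.continuousOn
  have hadd : ∀ y z, df (x, y + z) = df (x, y) + df (x, z) := by
    intro y z
    have hline : Tendsto (fun t : ℝ => ((x + t • y, z), t)) (𝓝[≠] 0) (𝓝 (x, z) ×ˢ 𝓝[≠] 0) := by
      refine Tendsto.prodMk ?_ tendsto_id
      have hcm : Continuous fun t : ℝ => (x + t • y, z) := by fun_prop
      exact (hcm.tendsto' 0 _ (by simp)).mono_left nhdsWithin_le_nhds
    have h1 := ((tendsto_differenceQuotient hU hd hc hx z).comp hline).add (hd x hx y)
    rw [add_comm (df (x, y))]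
    refine tendsto_nhds_unique (hd x hx (y + z)) (h1.congr fun t => ?_)
    simp only [Function.comp_apply, ← smul_add, sub_add_sub_cancel, add_assoc]
  have hsmul : ∀ (c : ℝ) (y : E), df (x, c • y) = c • df (x, y) := by
    intro c y
    rcases eq_or_ne c 0 with rfl | hc0
    · rw [zero_smul, zero_smul]
      refine tendsto_nhds_unique (hd x hx 0) ?_
      simp
    · have hline : Tendsto (fun t : ℝ => t * c) (𝓝[≠] 0) (𝓝[≠] 0) := by
        refine tendsto_nhdsWithin_iff.2 ⟨?_, ?_⟩
        · exact ((continuous_mul_const c).tendsto' 0 0 (by simp)).mono_left nhdsWithin_le_nhds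
        · filter_upwards [self_mem_nhdsWithin] with t ht
          exact mul_ne_zero ht hc0
      refine tendsto_nhds_unique (hd x hx (c • y))
        ((((hd x hx y).comp hline).const_smul c).congr fun t => ?_)
      simp only [Function.comp_apply, smul_smul, mul_inv_rev, mul_inv_cancel_left₀ hc0]
  refine ⟨{ toFun := fun y => df (x, y), map_add' := hadd, map_smul' := hsmul, cont := ?_ }, ?_⟩
  · have : ContinuousOn (fun y => df (x, y)) univ :=
      hc.comp (by fun_prop) fun y _ => ⟨hx, mem_univ _⟩
    exact continuousOn_univ.1 this
  · exact IsCk.hasHadamardDeriv hU hd hc hx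

/-- By the chain rule the derivative of `g ∘ f` is `dg ∘ (f ∘ fst, df)`, again a composition, of one
order less; hence the induction over all spaces at once. -/
theorem IsCk.comp [PolynormableSpace ℝ G] {k : ℕ} {U : Set E} {V : Set F} (hV : IsOpen V)
    {f : E → F} {g : F → G} (hg : IsCk k V g) (hf : IsCk k U f) (hUV : MapsTo f U V) :
    IsCk k U (g ∘ f) := by
  induction k generalizing E F with
  | zero => exact ContinuousOn.comp hg hf hUV
  | succ k ih =>
    have hf' := hf
    obtain ⟨hcf, df, hdf, hkf⟩ := hf
    obtain ⟨hcg, dg, hdg, hkg⟩ := hg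
    refine ⟨hcg.comp hcf hUV, fun p => dg (f p.1, df p), fun x hx y => ?_, ?_⟩
    · have h1 := IsCk.hasHadamardDeriv hV hdg hkg.continuousOn (hUV hx) (df (x, y))
      have h2 : Tendsto (fun t : ℝ => (t⁻¹ • (f (x + t • y) - f x), t)) (𝓝[≠] 0)
          (𝓝 (df (x, y)) ×ˢ 𝓝[≠] 0) := (hdf x hx y).prodMk tendsto_id
      refine (h1.comp h2).congr' ?_
      filter_upwards [self_mem_nhdsWithin] with t ht
      simp only [Function.comp_apply, smul_inv_smul₀ (show t ≠ 0 from ht), add_sub_cancel]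
    · have h1 : IsCk k (U ×ˢ (univ : Set E)) (f ∘ ContinuousLinearMap.fst ℝ E E) := by
        have := hf'.of_succ.comp_clm (ContinuousLinearMap.fst ℝ E E)
        rwa [prod_univ]
      exact ih (hV.prod isOpen_univ) hkg (h1.prodMk hkf) fun p hp => ⟨hUV hp.1, mem_univ _⟩

theorem IsCk.of_local [T2Space F] {k : ℕ} {U : Set E} (hU : IsOpen U) {f : E → F}
    (h : ∀ x ∈ U, ∃ V, IsOpen V ∧ x ∈ V ∧ IsCk k (U ∩ V) f) : IsCk k U f := by
  classical
  induction k generalizing E with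
  | zero =>
    intro x hx
    obtain ⟨V, hV, hxV, hf⟩ := h x hx
    exact (ContinuousOn.continuousAt hf ((hU.inter hV).mem_nhds ⟨hx, hxV⟩)).continuousWithinAt
  | succ k ih =>
    choose! V hV hxV hf using h
    have hc : ContinuousOn f U := fun x hx => ((hf x hx).1.continuousAt
      ((hU.inter (hV x hx)).mem_nhds ⟨hx, hxV x hx⟩)).continuousWithinAt
    choose! D hD hDk using fun x hx => (hf x hx).2
    have hDeq : ∀ x ∈ U, ∀ x' ∈ U ∩ V x, ∀ y, D x' (x', y) = D x (x', y) := fun x hx x' hx' y =>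
      tendsto_nhds_unique (hD x' hx'.1 x' ⟨hx'.1, hxV x' hx'.1⟩ y) (hD x hx x' hx' y)
    -- At each point the derivative chosen for that very point is used; by uniqueness of limits it
    -- agrees with the choices at nearby points.
    refine ⟨hc, fun p => D p.1 p, fun x hx y => hD x hx x ⟨hx, hxV x hx⟩ y, ?_⟩
    refine ih (hU.prod isOpen_univ) fun p hp => ⟨V p.1 ×ˢ univ, (hV _ hp.1).prod isOpen_univ,
      ⟨hxV _ hp.1, mem_univ _⟩, ?_⟩
    rw [prod_inter_prod, univ_inter]
    refine (hDk p.1 hp.1).congr ((hU.inter (hV _ hp.1)).prod isOpen_univ) fun p' hp' => ?_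
    exact (hDeq p.1 hp.1 p'.1 hp'.1 p'.2).symm

end Ck

/-! ### Properties common to all regularity classes. -/

section Cr

variable {𝕜 : Type} [RCLike 𝕜] {r : Regularity 𝕜} {E F G : Type*}
  [AddCommGroup E] [Module 𝕜 E] [TopologicalSpace E] [IsTopologicalAddGroup E]
  [ContinuousSMul 𝕜 E] [PolynormableSpace 𝕜 E] [T2Space E]
  [AddCommGroup F] [Module 𝕜 F] [TopologicalSpace F] [IsTopologicalAddGroup F]
  [ContinuousSMul 𝕜 F] [PolynormableSpace 𝕜 F] [T2Space F]
  [AddCommGroup G] [Module 𝕜 G] [TopologicalSpace G] [IsTopologicalAddGroup G]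
  [ContinuousSMul 𝕜 G] [PolynormableSpace 𝕜 G] [T2Space G]

theorem IsCr.continuousOn {U : Set E} {f : E → F} (hf : IsCr r U f) : ContinuousOn f U := by
  cases r with
  | finite k => exact IsCk.continuousOn hf
  | smooth => exact hf 0
  | realAnalytic => exact IsRealAnalytic.continuousOn hf
  | complexAnalytic => exact hf.1

theorem IsCr.mono {U V : Set E} (hV : IsOpen V) (hVU : V ⊆ U) {f : E → F} (hf : IsCr r U f) :
    IsCr r V f := by
  cases r with
  | finite k => exact IsCk.mono hVU hf
  | smooth => exact fun k => IsCk.mono hVU (hf k)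
  | realAnalytic => exact IsRealAnalytic.mono hVU hf
  | complexAnalytic => exact IsComplexAnalytic.mono hV hVU hf

theorem IsCr.congr {U : Set E} (hU : IsOpen U) {f g : E → F} (hf : IsCr r U f)
    (hfg : EqOn f g U) : IsCr r U g := by
  cases r with
  | finite k => exact IsCk.congr hU hf hfg
  | smooth => exact fun k => IsCk.congr hU (hf k) hfg
  | realAnalytic => exact IsRealAnalytic.congr hf hfg
  | complexAnalytic =>
    exact IsComplexAnalytic.of_local hU fun x hx => ⟨U, hU, hx, f, hf, fun y hy => (hfg hy.1).symm⟩

theorem isCr_clm (L : E →L[𝕜] F) {U : Set E} (hU : IsOpen U) : IsCr r U L := by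
  cases r with
  | finite k => exact isCk_clm k L U
  | smooth => exact fun k => isCk_clm k L U
  | realAnalytic => exact isRealAnalytic_clm L U
  | complexAnalytic => exact isComplexAnalytic_clm L hU

theorem IsCr.comp {U : Set E} {V : Set F} (hU : IsOpen U) (hV : IsOpen V) {f : E → F} {g : F → G}
    (hg : IsCr r V g) (hf : IsCr r U f) (hUV : MapsTo f U V) : IsCr r U (g ∘ f) := by
  cases r with
  | finite k => exact IsCk.comp hV hg hf hUV
  | smooth => exact fun k => IsCk.comp hV (hg k) (hf k) hUV
  | realAnalytic => exact IsRealAnalytic.comp hg hf hUV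
  | complexAnalytic => exact IsComplexAnalytic.comp hU hV hg hf hUV

theorem IsCr.prodMk {U : Set E} (hU : IsOpen U) {f : E → F} {g : E → G} (hf : IsCr r U f)
    (hg : IsCr r U g) : IsCr r U fun x => (f x, g x) := by
  cases r with
  | finite k => exact IsCk.prodMk hf hg
  | smooth => exact fun k => IsCk.prodMk (hf k) (hg k)
  | realAnalytic => exact IsRealAnalytic.prodMk hf hg
  | complexAnalytic => exact IsComplexAnalytic.prodMk hU hf hg

theorem IsCr.of_local {U : Set E} (hU : IsOpen U) {f : E → F}
    (h : ∀ x ∈ U, ∃ V, IsOpen V ∧ x ∈ V ∧ IsCr r (U ∩ V) f) : IsCr r U f := by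
  cases r with
  | finite k => exact IsCk.of_local hU h
  | smooth =>
    exact fun k => IsCk.of_local hU fun x hx =>
      let ⟨V, hV, hxV, hf⟩ := h x hx
      ⟨V, hV, hxV, hf k⟩
  | realAnalytic => exact IsRealAnalytic.of_local hU h
  | complexAnalytic =>
    refine IsComplexAnalytic.of_local hU fun x hx => ?_
    obtain ⟨V, hV, hxV, hf⟩ := h x hx
    exact ⟨U ∩ V, hU.inter hV, ⟨hx, hxV⟩, f, hf, eqOn_refl _ _⟩

theorem IsCr.exists_hadamardDeriv {U : Set E} (hU : IsOpen U) {f : E → F} (hf : IsCr r U f)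
    {x : E} (hx : x ∈ U) : ∃ A : E →L[𝕜] F, HasHadamardDeriv 𝕜 f A x := by
  cases r with
  | finite k =>
    obtain ⟨j, hj⟩ := Nat.exists_eq_succ_of_ne_zero k.ne_zero
    have hf : IsCk (k : ℕ) U f := hf
    rw [hj] at hf
    exact IsCk.exists_hadamardDeriv hU hf hx
  | smooth => exact IsCk.exists_hadamardDeriv hU (hf 1) hx
  | realAnalytic => exact IsRealAnalytic.exists_hadamardDeriv hU hf hx
  | complexAnalytic => exact IsComplexAnalytic.exists_hadamardDeriv hU hf hx

theorem IsCr.sub {U : Set E} (hU : IsOpen U) {f g : E → F} (hf : IsCr r U f) (hg : IsCr r U g) :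
    IsCr r U fun x => f x - g x :=
  (isCr_clm (r := r) (ContinuousLinearMap.fst 𝕜 F F - ContinuousLinearMap.snd 𝕜 F F)
    isOpen_univ).comp hU isOpen_univ (hf.prodMk hU hg) (mapsTo_univ _ _)

theorem IsCr.add {U : Set E} (hU : IsOpen U) {f g : E → F} (hf : IsCr r U f) (hg : IsCr r U g) :
    IsCr r U fun x => f x + g x :=
  (isCr_clm (r := r) (ContinuousLinearMap.fst 𝕜 F F + ContinuousLinearMap.snd 𝕜 F F)
    isOpen_univ).comp hU isOpen_univ (hf.prodMk hU hg) (mapsTo_univ _ _)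

theorem IsCr.clm_comp {U : Set E} (hU : IsOpen U) {f : E → F} (hf : IsCr r U f) (L : F →L[𝕜] G) :
    IsCr r U fun x => L (f x) :=
  (isCr_clm (r := r) L isOpen_univ).comp hU isOpen_univ hf (mapsTo_univ _ _)

end Cr

/-! ### Charts, submersions and adapted charts. -/

section Charts

variable {𝕜 : Type} [RCLike 𝕜] {r : Regularity 𝕜}
  {E : Type*} [AddCommGroup E] [Module 𝕜 E] [TopologicalSpace E] [IsTopologicalAddGroup E]
  [ContinuousSMul 𝕜 E] [PolynormableSpace 𝕜 E] [T2Space E]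
  {E' : Type*} [AddCommGroup E'] [Module 𝕜 E'] [TopologicalSpace E'] [IsTopologicalAddGroup E']
  [ContinuousSMul 𝕜 E'] [PolynormableSpace 𝕜 E'] [T2Space E']
  {F : Type*} [AddCommGroup F] [Module 𝕜 F] [TopologicalSpace F] [IsTopologicalAddGroup F]
  [ContinuousSMul 𝕜 F] [PolynormableSpace 𝕜 F] [T2Space F]
  {M : Type*} [TopologicalSpace M] [ChartedSpace E M]
  {M' : Type*} [TopologicalSpace M'] [ChartedSpace E' M']
  {N : Type*} [TopologicalSpace N] [ChartedSpace F N]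

theorem symm_apply_mem_source {X H : Type*} [TopologicalSpace X] [TopologicalSpace H]
    {φ φ' : OpenPartialHomeomorph X H} {v : H} (hv : v ∈ (φ.symm.trans φ').source) :
    φ.symm v ∈ φ'.source := hv.2

theorem apply_mem_transition_source {X H : Type*} [TopologicalSpace X] [TopologicalSpace H]
    {φ φ' : OpenPartialHomeomorph X H} {x : X} (hx : x ∈ φ.source) (hx' : x ∈ φ'.source) :
    φ x ∈ (φ.symm.trans φ').source :=
  ⟨φ.map_source hx, by change φ.symm (φ x) ∈ φ'.source; rwa [φ.left_inv hx]⟩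

theorem IsCr.of_local_eqOn {U : Set E} (hU : IsOpen U) {f : E → F}
    (h : ∀ x ∈ U, ∃ V, IsOpen V ∧ x ∈ V ∧ ∃ g, IsCr r (U ∩ V) g ∧ EqOn g f (U ∩ V)) :
    IsCr r U f := by
  refine IsCr.of_local hU fun x hx => ?_
  obtain ⟨V, hV, hxV, g, hg, hgf⟩ := h x hx
  exact ⟨V, hV, hxV, hg.congr (hU.inter hV) hgf⟩

theorem atlas_subset_maxAtlas (hM : IsCrManifold r E M) : atlas E M ⊆ maxAtlas r E M :=
  fun _ he e' he' => ⟨hM _ he e' he', hM e' he' _ he⟩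

/-- The changes of charts of the maximal atlas are `C^r`. -/
theorem isCr_transition {φ φ' : OpenPartialHomeomorph M E} (hφ : φ ∈ maxAtlas r E M)
    (hφ' : φ' ∈ maxAtlas r E M) : IsCr r (φ.symm.trans φ').source (φ' ∘ φ.symm) := by
  refine IsCr.of_local_eqOn (φ.symm.trans φ').open_source fun v hv => ?_
  -- Charts of the maximal atlas are only compared with the given atlas, so the transition is
  -- factored locally through a chart `e` of the latter.
  have he := chart_mem_atlas E (φ.symm v)
  set e := chartAt E (φ.symm v) with he_def
  have hO := (φ.symm.trans φ').open_source.inter (φ.symm.trans e).open_source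
  refine ⟨(φ.symm.trans e).source, (φ.symm.trans e).open_source,
    ⟨hv.1, mem_chart_source E (φ.symm v)⟩, (φ' ∘ e.symm) ∘ (e ∘ φ.symm), ?_, ?_⟩
  · refine (hφ' e he).2.comp hO (e.symm.trans φ').open_source
      ((hφ e he).1.mono hO inter_subset_right) ?_
    rintro w ⟨hw, hw'⟩
    refine ⟨e.map_source hw'.2, ?_⟩
    change e.symm (e (φ.symm w)) ∈ φ'.source
    rw [e.left_inv (symm_apply_mem_source hw')]
    exact hw.2
  · rintro w ⟨hw, hw'⟩
    change φ' (e.symm (e (φ.symm w))) = φ' (φ.symm w)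
    rw [e.left_inv (symm_apply_mem_source hw')]

theorem trans_mem_maxAtlas {φ : OpenPartialHomeomorph M E} (hφ : φ ∈ maxAtlas r E M)
    {T : OpenPartialHomeomorph E E} (hT : IsCr r T.source T) (hT' : IsCr r T.target T.symm) :
    φ.trans T ∈ maxAtlas r E M := by
  intro e he
  constructor
  · have hO := ((φ.trans T).symm.trans e).open_source
    refine (((hφ e he).1.comp hO (φ.symm.trans e).open_source
      (hT'.mono hO ?_) ?_)).congr hO fun v _ => rfl
    · intro v hv
      exact hv.1.1
    · intro v hv
      exact ⟨hv.1.2, hv.2⟩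
  · have hO := (e.symm.trans (φ.trans T)).open_source
    refine ((hT.comp hO T.open_source ((hφ e he).2.mono hO ?_) ?_)).congr hO fun v _ => rfl
    · intro v hv
      exact ⟨hv.1, hv.2.1⟩
    · intro v hv
      exact hv.2.2

theorem restr_mem_maxAtlas {φ : OpenPartialHomeomorph M E} (hφ : φ ∈ maxAtlas r E M) (O : Set M) :
    φ.restr O ∈ maxAtlas r E M := by
  intro e he
  constructor
  · refine (hφ e he).1.mono ((φ.restr O).symm.trans e).open_source ?_
    intro v hv
    exact ⟨hv.1.1, hv.2⟩
  · refine (hφ e he).2.mono (e.symm.trans (φ.restr O)).open_source ?_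
    intro v hv
    exact ⟨hv.1, hv.2.1⟩

theorem IsCr.prodMap {D D' : Type*}
    [AddCommGroup D] [Module 𝕜 D] [TopologicalSpace D] [IsTopologicalAddGroup D]
    [ContinuousSMul 𝕜 D] [PolynormableSpace 𝕜 D] [T2Space D]
    [AddCommGroup D'] [Module 𝕜 D'] [TopologicalSpace D'] [IsTopologicalAddGroup D']
    [ContinuousSMul 𝕜 D'] [PolynormableSpace 𝕜 D'] [T2Space D']
    {U : Set E} {U' : Set E'} (hU : IsOpen U) (hU' : IsOpen U') {f : E → D} {f' : E' → D'}
    (hf : IsCr r U f) (hf' : IsCr r U' f') : IsCr r (U ×ˢ U') (Prod.map f f') := by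
  have hO := hU.prod hU'
  exact (hf.comp hO hU (isCr_clm (ContinuousLinearMap.fst 𝕜 E E') hO) fun p hp => hp.1).prodMk hO
    (hf'.comp hO hU' (isCr_clm (ContinuousLinearMap.snd 𝕜 E E') hO) fun p hp => hp.2)

theorem prod_mem_maxAtlas {φ : OpenPartialHomeomorph M E} {φ' : OpenPartialHomeomorph M' E'}
    (hφ : φ ∈ maxAtlas r E M) (hφ' : φ' ∈ maxAtlas r E' M') :
    φ.prod φ' ∈ maxAtlas r (E × E') (M × M') := by
  rintro _ ⟨e, he, e', he', rfl⟩
  constructor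
  · refine (IsCr.prodMap (φ.symm.trans e).open_source (φ'.symm.trans e').open_source
      (hφ e he).1 (hφ' e' he').1).mono ((φ.prod φ').symm.trans (e.prod e')).open_source ?_
    rintro ⟨v, w⟩ hv
    exact ⟨⟨hv.1.1, hv.2.1⟩, hv.1.2, hv.2.2⟩
  · refine (IsCr.prodMap (e.symm.trans φ).open_source (e'.symm.trans φ').open_source
      (hφ e he).2 (hφ' e' he').2).mono ((e.prod e').symm.trans (φ.prod φ')).open_source ?_
    rintro ⟨v, w⟩ hv
    exact ⟨⟨hv.1.1, hv.2.1⟩, hv.1.2, hv.2.2⟩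

theorem equiv_trans_mem_maxAtlas {φ : OpenPartialHomeomorph M E} (hφ : φ ∈ maxAtlas r E M)
    (D : E ≃L[𝕜] E) : φ.trans D.toHomeomorph.toOpenPartialHomeomorph ∈ maxAtlas r E M :=
  trans_mem_maxAtlas hφ (isCr_clm (D : E →L[𝕜] E) isOpen_univ)
    (isCr_clm (D.symm : E →L[𝕜] E) isOpen_univ)

/-- A continuous map that is linear with continuous linear right inverse in suitable charts
is a submersion. -/
theorem isSubmersion_of_local {f : M → N} (hf : Continuous f)
    (h : ∀ x : M, ∃ φ ∈ maxAtlas r E M, ∃ ψ ∈ maxAtlas r F N,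
      x ∈ φ.source ∧ f x ∈ ψ.source ∧ MapsTo f φ.source ψ.source ∧
      ∃ (π : E →L[𝕜] F) (σ : F →L[𝕜] E), π.comp σ = ContinuousLinearMap.id 𝕜 F ∧
        ∀ v ∈ φ.target, ψ (f (φ.symm v)) = π v) :
    IsSubmersion r E F f := by
  refine ⟨⟨hf, fun φ' hφ' ψ' hψ' => ?_⟩, h⟩
  have hO : IsOpen (φ'.target ∩ φ'.symm ⁻¹' (f ⁻¹' ψ'.source)) :=
    φ'.symm.isOpen_inter_preimage (ψ'.open_source.preimage hf)
  refine IsCr.of_local_eqOn hO fun v hv => ?_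
  obtain ⟨φ, hφ, ψ, hψ, hxφ, -, hmap, π, -, -, hπ⟩ := h (φ'.symm v)
  have hV := (φ'.symm.trans φ).open_source
  have hval : ∀ w ∈ (φ'.symm.trans φ).source, π (φ (φ'.symm w)) = ψ (f (φ'.symm w)) := by
    intro w hw
    rw [← hπ _ (φ.map_source (symm_apply_mem_source hw)), φ.left_inv (symm_apply_mem_source hw)]
  have hinv : ∀ w ∈ (φ'.symm.trans φ).source, ψ.symm (π (φ (φ'.symm w))) = f (φ'.symm w) := by
    intro w hw
    rw [hval w hw, ψ.left_inv (hmap (symm_apply_mem_source hw))]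
  refine ⟨(φ'.symm.trans φ).source, hV, ⟨hv.1, hxφ⟩,
    (ψ' ∘ ψ.symm) ∘ fun w => π ((φ ∘ φ'.symm) w), ?_, ?_⟩
  · refine (isCr_transition hψ hψ').comp (hO.inter hV) (ψ.symm.trans ψ').open_source
      (((isCr_transition hφ' hφ).mono (hO.inter hV) inter_subset_right).clm_comp (hO.inter hV) π) ?_
    rintro w ⟨hw, hw'⟩
    refine ⟨?_, ?_⟩
    · change π (φ (φ'.symm w)) ∈ ψ.target
      rw [hval w hw']
      exact ψ.map_source (hmap hw'.2)
    · change ψ.symm (π (φ (φ'.symm w))) ∈ ψ'.source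
      rw [hinv w hw']
      exact hw.2
  · rintro w ⟨hw, hw'⟩
    change ψ' (ψ.symm (π (φ (φ'.symm w)))) = ψ' (f (φ'.symm w))
    rw [hinv w hw']

theorem isAdapted_iff {S : Set M} {Y : Submodule 𝕜 E} {φ : OpenPartialHomeomorph M E} :
    IsAdapted S Y φ ↔ ∀ x ∈ φ.source, (φ x ∈ Y ↔ x ∈ S) := by
  refine ⟨fun h x hx => h.mem_iff hx, fun h => ?_⟩
  ext v
  constructor
  · rintro ⟨x, ⟨hx, hxS⟩, rfl⟩
    exact ⟨φ.map_source hx, (h x hx).2 hxS⟩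
  · rintro ⟨hv, hvY⟩
    have hx := φ.map_target hv
    refine ⟨φ.symm v, ⟨hx, (h _ hx).1 ?_⟩, φ.right_inv hv⟩
    rwa [φ.right_inv hv]

/-- Straightening of a subset that is the graph of a `C^r`-map in a chart. -/
theorem exists_isAdapted_ker {S : Set M} {χ : OpenPartialHomeomorph M E}
    (hχ : χ ∈ maxAtlas r E M) {π : E →L[𝕜] F} {σ : F →L[𝕜] E} {ρ : E →L[𝕜] E'} {k : E' → F}
    {U : Set E'} (hU : IsOpen U) (hk : IsCr r U k) (hρU : MapsTo ρ χ.target U)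
    (hπσ : ∀ z, π (σ z) = z) (hρσ : ∀ z, ρ (σ z) = 0)
    (hS : ∀ x ∈ χ.source, x ∈ S ↔ π (χ x) = k (ρ (χ x))) :
    ∃ Φ ∈ maxAtlas r E M, Φ.source = χ.source ∧ IsAdapted S (π : E →ₗ[𝕜] F).ker Φ ∧
      ∀ x ∈ χ.source, ρ (Φ x) = ρ (χ x) := by
  have hO : IsOpen (ρ ⁻¹' U) := hU.preimage ρ.continuous
  have hkρ : IsCr r (ρ ⁻¹' U) fun v => σ (k (ρ v)) :=
    (hk.comp hO hU (isCr_clm ρ hO) fun v hv => hv).clm_comp hO σ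
  have hid : IsCr r (ρ ⁻¹' U) fun v : E => v := isCr_clm (ContinuousLinearMap.id 𝕜 E) hO
  have hρ1 : ∀ v, ρ (v - σ (k (ρ v))) = ρ v := fun v => by rw [map_sub, hρσ, sub_zero]
  have hρ2 : ∀ v, ρ (v + σ (k (ρ v))) = ρ v := fun v => by rw [map_add, hρσ, add_zero]
  -- The shear along `range σ`. As `ρ ∘ σ = 0`, it does not change `k (ρ v)`, so subtracting and
  -- adding `σ (k (ρ v))` are mutually inverse.
  let T : OpenPartialHomeomorph E E :=
    { toFun := fun v => v - σ (k (ρ v))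
      invFun := fun v => v + σ (k (ρ v))
      source := ρ ⁻¹' U
      target := ρ ⁻¹' U
      map_source' := fun v hv => by rwa [mem_preimage, hρ1]
      map_target' := fun v hv => by rwa [mem_preimage, hρ2]
      left_inv' := fun v _ => by rw [hρ1, sub_add_cancel]
      right_inv' := fun v _ => by rw [hρ2, add_sub_cancel_right]
      open_source := hO
      open_target := hO
      continuousOn_toFun := (hid.sub hO hkρ).continuousOn
      continuousOn_invFun := (hid.add hO hkρ).continuousOn }
  have hsrc : (χ.trans T).source = χ.source := by
    rw [OpenPartialHomeomorph.trans_source]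
    exact inter_eq_left.2 fun _ hx => hρU (χ.map_source hx)
  refine ⟨χ.trans T, trans_mem_maxAtlas hχ (hid.sub hO hkρ) (hid.add hO hkρ), hsrc, ?_,
    fun x _ => hρ1 (χ x)⟩
  rw [isAdapted_iff, hsrc]
  intro x hx
  rw [hS x hx, LinearMap.mem_ker]
  change π (χ x - σ (k (ρ (χ x)))) = 0 ↔ _
  rw [map_sub, hπσ, sub_eq_zero]

theorem HasHadamardDeriv.unique {f A B : E → F} {x : E} (hA : HasHadamardDeriv 𝕜 f A x)
    (hB : HasHadamardDeriv 𝕜 f B x) : A = B :=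
  funext fun y => tendsto_nhds_unique (hA y) (hB y)

theorem hasHadamardDeriv_id (x : E) : HasHadamardDeriv 𝕜 (id : E → E) id x := by
  intro y
  have h : Filter.Tendsto (fun p : E × 𝕜 => p.1) (𝓝 y ×ˢ 𝓝[≠] 0) (𝓝 y) := Filter.tendsto_fst
  refine h.congr' ?_
  have hne : ∀ᶠ p : E × 𝕜 in 𝓝 y ×ˢ 𝓝[≠] 0, p.2 ≠ 0 :=
    Filter.tendsto_snd.eventually self_mem_nhdsWithin
  filter_upwards [hne] with p hp
  simp [hp]

/-- The derivative of a change of charts maps tangent vectors of a submanifold to tangent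
vectors. -/
theorem IsAdapted.hadamardDeriv_mem {S : Set M} {Y Y' : Submodule 𝕜 E}
    {φ φ' : OpenPartialHomeomorph M E} (h : IsAdapted S Y φ) (h' : IsAdapted S Y' φ')
    (hY' : IsClosed (Y' : Set E)) {x : M} (hxS : x ∈ S) (hx : x ∈ φ.source) (hx' : x ∈ φ'.source)
    {A : E → E} (hA : HasHadamardDeriv 𝕜 (φ' ∘ φ.symm) A (φ x)) {y : E} (hy : y ∈ Y) : A y ∈ Y' := by
  have hline : Filter.Tendsto (fun t : 𝕜 => (y, t)) (𝓝[≠] 0) (𝓝 y ×ˢ 𝓝[≠] 0) :=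
    tendsto_const_nhds.prodMk Filter.tendsto_id
  -- For small `t` the difference quotients in direction `y` lie in `Y'`, because `φ x` and `φ x + t
  -- • y` lie in `Y` and the change of charts preserves `S`.
  refine hY'.mem_of_tendsto ((hA y).comp hline) ?_
  have hO := (φ.symm.trans φ').open_source
  have hmem : φ x ∈ (φ.symm.trans φ').source := apply_mem_transition_source hx hx'
  have hc : Continuous fun t : 𝕜 => φ x + t • y := by fun_prop
  have hT : ∀ v ∈ (φ.symm.trans φ').source, v ∈ Y → φ' (φ.symm v) ∈ Y' := fun v hv hvY =>
    (h'.mem_iff hv.2).2 ((h.symm_mem_iff hv.1).2 hvY)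
  have hxY : φ x ∈ Y := (h.mem_iff hx).2 hxS
  filter_upwards [((hc.tendsto' 0 (φ x) (by simp)).mono_left nhdsWithin_le_nhds).eventually
    (hO.mem_nhds hmem)] with t ht
  exact Y'.smul_mem _ (Y'.sub_mem (hT _ ht (Y.add_mem hxY (Y.smul_mem t hy))) (hT _ hmem hxY))

/-- Any two model subspaces of a submanifold at a point are related by an automorphism of
the ambient modelling space. -/
theorem IsAdapted.exists_equiv {S : Set M} {Y Y' : Submodule 𝕜 E}
    {φ φ' : OpenPartialHomeomorph M E} (h : IsAdapted S Y φ) (h' : IsAdapted S Y' φ')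
    (hφ : φ ∈ maxAtlas r E M) (hφ' : φ' ∈ maxAtlas r E M)
    (hY : IsClosed (Y : Set E)) (hY' : IsClosed (Y' : Set E)) {x : M} (hxS : x ∈ S)
    (hx : x ∈ φ.source) (hx' : x ∈ φ'.source) :
    ∃ D : E ≃L[𝕜] E, ∀ v, D v ∈ Y' ↔ v ∈ Y := by
  -- Chain rule for the two mutually inverse changes of charts.
  have key : ∀ {φ φ' : OpenPartialHomeomorph M E}, x ∈ φ.source → x ∈ φ'.source → ∀ {A B : E → E},
      HasHadamardDeriv 𝕜 (φ' ∘ φ.symm) A (φ x) → HasHadamardDeriv 𝕜 (φ ∘ φ'.symm) B (φ' x) →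
      B ∘ A = id := by
    intro φ φ' hx hx' A B hA hB
    have hval : (φ' ∘ φ.symm) (φ x) = φ' x := by
      rw [Function.comp_apply, φ.left_inv hx]
    rw [← hval] at hB
    refine (hB.comp hA).unique ((hasHadamardDeriv_id (φ x)).congr ?_)
    refine Filter.eventuallyEq_of_mem ((φ.symm.trans φ').open_source.mem_nhds
      (apply_mem_transition_source hx hx')) fun v hv => ?_
    change v = φ (φ'.symm (φ' (φ.symm v)))
    rw [φ'.left_inv (symm_apply_mem_source hv), φ.right_inv hv.1]
  obtain ⟨A, hA⟩ := (isCr_transition hφ hφ').exists_hadamardDeriv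
    (φ.symm.trans φ').open_source (apply_mem_transition_source hx hx')
  obtain ⟨B, hB⟩ := (isCr_transition hφ' hφ).exists_hadamardDeriv
    (φ'.symm.trans φ).open_source (apply_mem_transition_source hx' hx)
  have hBA : Function.LeftInverse B A := fun v => congrFun (key hx hx' hA hB) v
  have hAB : Function.RightInverse B A := fun v => congrFun (key hx' hx hB hA) v
  refine ⟨ContinuousLinearEquiv.equivOfInverse A B hBA hAB, fun v => ⟨fun hv => ?_, fun hv => ?_⟩⟩
  · have := h'.hadamardDeriv_mem h hY hxS hx' hx hB hv
    change B (A v) ∈ Y at this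
    rwa [hBA] at this
  · exact h.hadamardDeriv_mem h' hY' hxS hx hx' hA hv

theorem IsAdapted.trans_equiv {S : Set M} {Y Y' : Submodule 𝕜 E}
    {φ : OpenPartialHomeomorph M E} (h : IsAdapted S Y φ) {D : E ≃L[𝕜] E}
    (hD : ∀ v, D v ∈ Y' ↔ v ∈ Y) :
    IsAdapted S Y' (φ.trans D.toHomeomorph.toOpenPartialHomeomorph) := by
  rw [isAdapted_iff]
  intro x hx
  exact (hD (φ x)).trans (h.mem_iff hx.1)

/-- As `C` is open in `S`, it is the trace on `S` of an open set `O` of `M`; over `O` the sets `S`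
and `C` coincide. -/
theorem IsAdapted.exists_restr {S C : Set M} {Y : Submodule 𝕜 E}
    {φ : OpenPartialHomeomorph M E} (h : IsAdapted S Y φ) (hφ : φ ∈ maxAtlas r E M) (hCS : C ⊆ S)
    (hC : IsOpen (Subtype.val ⁻¹' C : Set S)) {x : M} (hxC : x ∈ C) :
    ∃ O : Set M, IsOpen O ∧ x ∈ O ∧ φ.restr O ∈ maxAtlas r E M ∧ IsAdapted C Y (φ.restr O) := by
  obtain ⟨O, hO, hOC⟩ := isOpen_induced_iff.1 hC
  have hiff : ∀ y ∈ S, y ∈ O ↔ y ∈ C := fun y hy => by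
    have := congrArg (fun s : Set S => (⟨y, hy⟩ : S) ∈ s) hOC
    exact this.to_iff
  refine ⟨O, hO, (hiff x (hCS hxC)).2 hxC, restr_mem_maxAtlas hφ O, ?_⟩
  rw [isAdapted_iff]
  intro y hy
  rw [φ.restr_source' O hO] at hy
  refine (h.mem_iff hy.1).trans ⟨fun hyS => (hiff y hyS).1 hy.2, fun hyC => hCS hyC⟩

end Charts

/-! ### From adapted charts to submanifolds and submersions. -/

section Submanifolds

variable {𝕜 : Type} [RCLike 𝕜] {r : Regularity 𝕜}
  {E : Type*} [AddCommGroup E] [Module 𝕜 E] [TopologicalSpace E] [IsTopologicalAddGroup E]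
  [ContinuousSMul 𝕜 E] [PolynormableSpace 𝕜 E] [T2Space E]
  {F : Type*} [AddCommGroup F] [Module 𝕜 F] [TopologicalSpace F] [IsTopologicalAddGroup F]
  [ContinuousSMul 𝕜 F] [PolynormableSpace 𝕜 F] [T2Space F]
  {M : Type*} [TopologicalSpace M] [ChartedSpace E M]
  {N : Type*} [TopologicalSpace N] [ChartedSpace F N]

omit [PolynormableSpace 𝕜 E] [T2Space E] [ChartedSpace E M] in
/-- A set with adapted charts is locally connected: each point has a neighbourhood whose trace on
the set lies in the connected component of the point. -/
theorem IsAdapted.mem_nhds_connectedComponentIn {S : Set M} {Y : Submodule 𝕜 E}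
    {φ : OpenPartialHomeomorph M E} (h : IsAdapted S Y φ) {c : M} (hcS : c ∈ S)
    (hc : c ∈ φ.source) : ∃ O ∈ 𝓝 c, O ∩ S ⊆ connectedComponentIn S c := by
  have hV : {v : E | φ c + v ∈ φ.target} ∈ 𝓝 (0 : E) := by
    refine (continuous_const_add (φ c)).continuousAt.preimage_mem_nhds ?_
    rw [add_zero]
    exact φ.open_target.mem_nhds (φ.map_source hc)
  -- A balanced set contains the segments from `0` to its points. Segments inside `Y` are pulled
  -- back by the chart to paths in `S` that start at `c`.
  set B := balancedCore 𝕜 {v : E | φ c + v ∈ φ.target} with hB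
  have hBn : B ∈ 𝓝 (0 : E) := balancedCore_mem_nhds_zero hV
  have hBb : Balanced 𝕜 B := balancedCore_balanced _
  have hBV : ∀ v ∈ B, φ c + v ∈ φ.target := fun v hv =>
    balancedCore_subset (𝕜 := 𝕜) {v : E | φ c + v ∈ φ.target} hv
  have hcY : φ c ∈ Y := (h.mem_iff hc).2 hcS
  refine ⟨φ.source ∩ φ ⁻¹' {v | v - φ c ∈ B}, ?_, ?_⟩
  · refine Filter.inter_mem (φ.open_source.mem_nhds hc)
      ((φ.continuousAt hc).preimage_mem_nhds ?_)
    refine (continuous_id.sub continuous_const).continuousAt.preimage_mem_nhds ?_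
    simpa using hBn
  rintro x ⟨⟨hx, hxB⟩, hxS⟩
  have hxB : φ x - φ c ∈ B := hxB
  have hxY : φ x - φ c ∈ Y := Y.sub_mem ((h.mem_iff hx).2 hxS) hcY
  let γ : ℝ → M := fun t => φ.symm (φ c + (t : 𝕜) • (φ x - φ c))
  have hmem : ∀ t ∈ Icc (0 : ℝ) 1, φ c + (t : 𝕜) • (φ x - φ c) ∈ φ.target := by
    intro t ht
    refine hBV _ (hBb.smul_mem ?_ hxB)
    simpa [abs_of_nonneg ht.1] using ht.2
  have hγc : ContinuousOn γ (Icc 0 1) := by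
    refine φ.symm.continuousOn.comp (Continuous.continuousOn ?_) hmem
    have := RCLike.continuous_ofReal (K := 𝕜)
    fun_prop
  have hγ0 : γ 0 = c := by simp [γ, φ.left_inv hc]
  have hγ1 : γ 1 = x := by simp [γ, φ.left_inv hx]
  have hsub : γ '' Icc 0 1 ⊆ connectedComponentIn S c := by
    refine (isPreconnected_Icc.image γ hγc).subset_connectedComponentIn
      ⟨0, by simp, hγ0⟩ ?_
    rintro _ ⟨t, ht, rfl⟩
    exact (h.symm_mem_iff (hmem t ht)).2 (Y.add_mem hcY (Y.smul_mem _ hxY))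
  exact hsub ⟨1, by simp, hγ1⟩

omit [PolynormableSpace 𝕜 E] [T2Space E] in
theorem isOpen_component_of_isAdapted {S : Set M}
    (h : ∀ x ∈ S, ∃ φ ∈ maxAtlas r E M, x ∈ φ.source ∧ ∃ Y : Submodule 𝕜 E, IsAdapted S Y φ)
    {C : Set M} (hC : C ∈ components S) : IsOpen (Subtype.val ⁻¹' C : Set S) := by
  obtain ⟨x₀, -, rfl⟩ := hC
  rw [isOpen_iff_mem_nhds]
  rintro ⟨c, hcS⟩ hc
  obtain ⟨φ, -, hcφ, Y, hφ⟩ := h c hcS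
  obtain ⟨O, hO, hOS⟩ := hφ.mem_nhds_connectedComponentIn hcS hcφ
  refine Filter.mem_of_superset (continuous_subtype_val.continuousAt.preimage_mem_nhds hO) ?_
  rintro ⟨y, hyS⟩ hy
  rw [mem_preimage, connectedComponentIn_eq hc]
  exact hOS ⟨hy, hyS⟩

theorem component_subset {X : Type*} [TopologicalSpace X] {S C : Set X} (hC : C ∈ components S) :
    C ⊆ S := by
  obtain ⟨x, -, rfl⟩ := hC
  exact connectedComponentIn_subset S x

/-- A subset with adapted charts, modelled on complemented subspaces, around each of its points is
a split submanifold; on each component, one model subspace suffices. -/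
theorem isSplitSubmanifoldNotPure_of_isAdapted {S : Set M}
    (h : ∀ x ∈ S, ∃ φ ∈ maxAtlas r E M, x ∈ φ.source ∧ ∃ Y : Submodule 𝕜 E, IsAdapted S Y φ ∧
      IsClosed (Y : Set E) ∧ ∃ Z : Submodule 𝕜 E, Submodule.IsTopCompl Y Z) :
    IsSplitSubmanifoldNotPure r E S := by
  intro C hC
  have hCo : IsOpen (Subtype.val ⁻¹' C : Set S) := by
    refine isOpen_component_of_isAdapted (E := E) (r := r) (fun x hx => ?_) hC
    obtain ⟨φ, hφ, hxφ, Y, hY, -⟩ := h x hx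
    exact ⟨φ, hφ, hxφ, Y, hY⟩
  refine ⟨hCo, ?_⟩
  have hCS := component_subset hC
  obtain ⟨x₀, hx₀S, hCx₀⟩ := hC
  have hx₀ : x₀ ∈ C := by rw [hCx₀]; exact mem_connectedComponentIn hx₀S
  have hCpre : IsPreconnected C := by rw [hCx₀]; exact isPreconnected_connectedComponentIn
  obtain ⟨φ₀, hφ₀, hxφ₀, Y, hY, hYc, hYs⟩ := h x₀ hx₀S
  refine ⟨Y, ⟨⟨hYc, ?_⟩, hYs⟩⟩
  suffices hgood : ∀ x ∈ C, ∃ φ ∈ maxAtlas r E M, x ∈ φ.source ∧ IsAdapted S Y φ by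
    intro x hx
    obtain ⟨φ, hφ, hxφ, hφS⟩ := hgood x hx
    obtain ⟨O, hO, hxO, hres, had⟩ := hφS.exists_restr hφ hCS hCo hx
    refine ⟨φ.restr O, hres, ?_, had⟩
    rw [φ.restr_source' O hO]
    exact ⟨hxφ, hxO⟩
  -- `u` covers the points with model `Y`, `v` those with a model not related to `Y` by an
  -- automorphism of `E`. Both are open, they cover `C`, and they cannot meet on `C` by
  -- `IsAdapted.exists_equiv`; since `x₀ ∈ u`, connectedness leaves nothing of `C` in `v`.
  set u : Set M := ⋃ φ ∈ {φ ∈ maxAtlas r E M | IsAdapted S Y φ}, φ.source with hu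
  set v : Set M := ⋃ φ ∈ {φ ∈ maxAtlas r E M | ∃ Y' : Submodule 𝕜 E, IsAdapted S Y' φ ∧
    IsClosed (Y' : Set E) ∧ ¬ ∃ D : E ≃L[𝕜] E, ∀ w, D w ∈ Y ↔ w ∈ Y'}, φ.source with hv
  have huo : IsOpen u := isOpen_biUnion fun φ _ => φ.open_source
  have hvo : IsOpen v := isOpen_biUnion fun φ _ => φ.open_source
  have hcover : C ⊆ u ∪ v := by
    intro x hx
    obtain ⟨φ, hφ, hxφ, Y', hY', hYc', -⟩ := h x (hCS hx)
    by_cases hD : ∃ D : E ≃L[𝕜] E, ∀ w, D w ∈ Y ↔ w ∈ Y'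
    · obtain ⟨D, hD⟩ := hD
      exact Or.inl (mem_biUnion (x := φ.trans D.toHomeomorph.toOpenPartialHomeomorph)
        ⟨equiv_trans_mem_maxAtlas hφ D, hY'.trans_equiv hD⟩ ⟨hxφ, mem_univ _⟩)
    · exact Or.inr (mem_biUnion (x := φ) ⟨hφ, Y', hY', hYc', hD⟩ hxφ)
  have hdisj : ¬ (C ∩ (u ∩ v)).Nonempty := by
    rintro ⟨x, hxC, hxu, hxv⟩
    obtain ⟨φ, ⟨hφ, hφS⟩, hxφ⟩ := mem_iUnion₂.1 hxu
    obtain ⟨φ', ⟨hφ', Y', hφ'S, hYc', hno⟩, hxφ'⟩ := mem_iUnion₂.1 hxv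
    exact hno (hφ'S.exists_equiv hφS hφ' hφ hYc' hYc (hCS hxC) hxφ' hxφ)
  intro x hx
  rcases hcover hx with hxu | hxv
  · obtain ⟨φ, ⟨hφ, hφS⟩, hxφ⟩ := mem_iUnion₂.1 hxu
    exact ⟨φ, hφ, hxφ, hφS⟩
  · exact absurd (hCpre u v huo hvo hcover
      ⟨x₀, hx₀, mem_biUnion (x := φ₀) ⟨hφ₀, hY⟩ hxφ₀⟩ ⟨x, hx, hxv⟩) hdisj

omit [IsTopologicalAddGroup E] [ContinuousSMul 𝕜 E] [PolynormableSpace 𝕜 E] [T2Space E]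
  [ChartedSpace E M] in
theorem IsAdapted.coe_chart {S : Set M} {Y : Submodule 𝕜 E} {φ : OpenPartialHomeomorph M E}
    (h : IsAdapted S Y φ) (c₀ : S) {c : S} (hc : (c : M) ∈ φ.source) :
    (h.chart c₀ c : E) = φ c := by
  classical
  have hY : φ c ∈ Y := (h.mem_iff hc).2 c.2
  change ((if hc : φ c ∈ Y then (⟨φ c, hc⟩ : Y) else 0 : Y) : E) = φ c
  rw [dif_pos hY]

omit [IsTopologicalAddGroup E] [ContinuousSMul 𝕜 E] [PolynormableSpace 𝕜 E] [T2Space E]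
  [ChartedSpace E M] in
theorem IsAdapted.coe_chart_symm {S : Set M} {Y : Submodule 𝕜 E} {φ : OpenPartialHomeomorph M E}
    (h : IsAdapted S Y φ) (c₀ : S) {v : Y} (hv : (v : E) ∈ φ.target) :
    ((h.chart c₀).symm v : M) = φ.symm v := by
  classical
  have hS : φ.symm v ∈ S := (h.symm_mem_iff hv).2 v.2
  change ((if hv : φ.symm v ∈ S then (⟨φ.symm v, hv⟩ : S) else c₀ : S) : M) = φ.symm v
  rw [dif_pos hS]

/-- A split submanifold is a `C^r`-manifold. -/
theorem IsSplitSubmanifold.isCrManifold {S : Set M} {Y : Submodule 𝕜 E}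
    (h : IsSplitSubmanifold r S Y) :
    letI : ChartedSpace Y S := h.toIsSubmanifold.chartedSpace
    IsCrManifold r Y S := by
  let : ChartedSpace Y S := h.toIsSubmanifold.chartedSpace
  obtain ⟨Z, hYZ⟩ := h.complemented
  rintro _ ⟨φ, hφ, hφS, c, rfl⟩ _ ⟨φ', hφ', hφS', c', rfl⟩
  set θ := hφS.chart c
  set θ' := hφS'.chart c'
  have hO := (θ.symm.trans θ').open_source
  have hmem : ∀ v ∈ (θ.symm.trans θ').source, (v : E) ∈ (φ.symm.trans φ').source := by
    intro v hv
    have h1 : (v : E) ∈ φ.target := hv.1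
    have h2 : ((θ.symm v : S) : M) ∈ φ'.source := hv.2
    rw [hφS.coe_chart_symm c h1] at h2
    exact ⟨h1, h2⟩
  -- The ambient transition is `C^r` as a map into `E`. The continuous projection onto `Y` along `Z`
  -- makes it `C^r` into `Y`; it changes nothing, as the values lie in `Y` already.
  have hT : IsCr r (θ.symm.trans θ').source fun v : Y =>
      Y.projectionOntoL Z hYZ ((φ' ∘ φ.symm) (Y.subtypeL v)) :=
    ((isCr_transition hφ hφ').comp hO (φ.symm.trans φ').open_source
      (isCr_clm Y.subtypeL hO) hmem).clm_comp hO _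
  refine hT.congr hO fun v hv => ?_
  have h1 : (v : E) ∈ φ.target := (hmem v hv).1
  have h2 : ((θ.symm v : S) : M) = φ.symm v := hφS.coe_chart_symm c h1
  have h3 : ((θ.symm v : S) : M) ∈ φ'.source := hv.2
  have h4 : ((θ' (θ.symm v) : Y) : E) = φ' (φ.symm v) := by
    rw [← h2]; exact hφS'.coe_chart c' h3
  change Y.projectionOntoL Z hYZ (φ' (φ.symm v)) = θ' (θ.symm v)
  rw [← h4, Submodule.projectionOntoL_apply_left]

/-- A map which in suitable adapted charts is the restriction of a split linear surjection
restricts to a submersion. -/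
theorem restrictsToSubmersion_of_isAdapted {S : Set M} {p : M → N} (hp : Continuous p)
    (h : ∀ x ∈ S, ∃ φ ∈ maxAtlas r E M, x ∈ φ.source ∧ ∃ Y : Submodule 𝕜 E, IsAdapted S Y φ ∧
      IsClosed (Y : Set E) ∧ ∃ ψ ∈ maxAtlas r F N, MapsTo p φ.source ψ.source ∧
      ∃ (ρ : E →L[𝕜] F) (τ : F →L[𝕜] E), (∀ z, ρ (τ z) = z) ∧ (∀ z, τ z ∈ Y) ∧
        ∀ y ∈ φ.source, ψ (p y) = ρ (φ y)) :
    RestrictsToSubmersion r E F S p := by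
  intro C hC Y hY
  let : ChartedSpace Y C := hY.toIsSubmanifold.chartedSpace
  refine ⟨hY.isCrManifold, isSubmersion_of_local (hp.comp continuous_subtype_val) ?_⟩
  rintro ⟨c, hc⟩
  have hCo : IsOpen (Subtype.val ⁻¹' C : Set S) := by
    refine isOpen_component_of_isAdapted (E := E) (r := r) (fun x hx => ?_) hC
    obtain ⟨φ, hφ, hxφ, Y, hY, -⟩ := h x hx
    exact ⟨φ, hφ, hxφ, Y, hY⟩
  obtain ⟨φ, hφ, hcφ, Y₀, hφS, hY₀, ψ, hψ, hmap, ρ, τ, hρτ, hτ, hloc⟩ := h c (component_subset hC hc)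
  obtain ⟨O, hO, hcO, hres, had⟩ := hφS.exists_restr hφ (component_subset hC) hCo hc
  have hcres : c ∈ (φ.restr O).source := by
    rw [φ.restr_source' O hO]
    exact ⟨hcφ, hcO⟩
  obtain ⟨φ', hφ', hcφ', had'⟩ := hY.exists_chart c hc
  -- The prescribed model `Y` of `C` may differ from the model `Y₀` of the given chart. The chart is
  -- moved by `D` with `D Y₀ = Y`; accordingly `ρ` becomes `ρ ∘ D⁻¹` and its section `τ` becomes `D
  -- ∘ τ`, which lands in `Y`.
  obtain ⟨D, hD⟩ := had.exists_equiv had' hres hφ' hY₀ hY.isClosed hc hcres hcφ'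
  set Φ := (φ.restr O).trans D.toHomeomorph.toOpenPartialHomeomorph with hΦ
  have hΦm : Φ ∈ maxAtlas r E M := equiv_trans_mem_maxAtlas hres D
  have hΦC : IsAdapted C Y Φ := had.trans_equiv hD
  have hΦsrc : ∀ y ∈ Φ.source, y ∈ φ.source := fun y hy => hy.1.1
  refine ⟨hΦC.chart ⟨c, hc⟩, atlas_subset_maxAtlas hY.isCrManifold ⟨Φ, hΦm, hΦC, ⟨c, hc⟩, rfl⟩,
    ψ, hψ, ⟨hcres, mem_univ _⟩, hmap hcφ, fun y hy => hmap (hΦsrc _ hy),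
    (ρ.comp (D.symm : E →L[𝕜] E)).comp Y.subtypeL,
    ((D : E →L[𝕜] E).comp τ).codRestrict Y fun z => (hD _).2 (hτ z), ?_, ?_⟩
  · ext z
    change ρ (D.symm (D (τ z))) = z
    rw [D.symm_apply_apply, hρτ]
  · intro v hv
    have hv : (v : E) ∈ Φ.target := hv
    change ψ (p ((hΦC.chart ⟨c, hc⟩).symm v : C)) = ρ (D.symm v)
    rw [hΦC.coe_chart_symm _ hv]
    have h1 := Φ.map_target hv
    have h2 : D (φ (Φ.symm v)) = v := Φ.right_inv hv
    rw [hloc _ (hΦsrc _ h1), ← D.symm_apply_apply (φ (Φ.symm v)), h2]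

/-- The local structure of a fibre product `{x | f₁ x = g₁ x}` given by a straightened equation. -/
theorem isSplitSubmanifold_and_restrictsToSubmersion
    {F' : Type*} [AddCommGroup F'] [Module 𝕜 F'] [TopologicalSpace F'] [IsTopologicalAddGroup F']
    [ContinuousSMul 𝕜 F'] [PolynormableSpace 𝕜 F'] [T2Space F']
    {S : Set M} {p : M → N} (hp : Continuous p)
    (h : ∀ x ∈ S, ∃ χ ∈ maxAtlas r E M, x ∈ χ.source ∧ ∃ ψ ∈ maxAtlas r F N,
      MapsTo p χ.source ψ.source ∧
      ∃ (π : E →L[𝕜] F') (σ : F' →L[𝕜] E) (ρ : E →L[𝕜] F) (τ : F →L[𝕜] E) (k : F → F'),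
        (∀ z, π (σ z) = z) ∧ (∀ z, ρ (σ z) = 0) ∧ (∀ z, ρ (τ z) = z) ∧ (∀ z, π (τ z) = 0) ∧
        IsCr r ψ.target k ∧ ∀ y ∈ χ.source, ψ (p y) = ρ (χ y) ∧ (y ∈ S ↔ π (χ y) = k (ρ (χ y)))) :
    IsSplitSubmanifoldNotPure r E S ∧ RestrictsToSubmersion r E F S p := by
  have key : ∀ x ∈ S, ∃ Φ ∈ maxAtlas r E M, x ∈ Φ.source ∧ ∃ Y : Submodule 𝕜 E, IsAdapted S Y Φ ∧
      IsClosed (Y : Set E) ∧ (∃ Z : Submodule 𝕜 E, Submodule.IsTopCompl Y Z) ∧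
      ∃ ψ ∈ maxAtlas r F N, MapsTo p Φ.source ψ.source ∧
      ∃ (ρ : E →L[𝕜] F) (τ : F →L[𝕜] E), (∀ z, ρ (τ z) = z) ∧ (∀ z, τ z ∈ Y) ∧
        ∀ y ∈ Φ.source, ψ (p y) = ρ (Φ y) := by
    intro x hx
    obtain ⟨χ, hχ, hxχ, ψ, hψ, hmap, π, σ, ρ, τ, k, hπσ, hρσ, hρτ, hπτ, hk, hy⟩ := h x hx
    have hρU : MapsTo ρ χ.target ψ.target := by
      intro v hv
      have h1 := χ.map_target hv
      have h2 := (hy _ h1).1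
      rw [χ.right_inv hv] at h2
      rw [← h2]
      exact ψ.map_source (hmap h1)
    obtain ⟨Φ, hΦ, hsrc, hΦS, hΦρ⟩ := exists_isAdapted_ker hχ ψ.open_target hk hρU hπσ hρσ
      fun y hyχ => (hy y hyχ).2
    -- The model subspace is `ker π`, with complement `range σ`; it contains the values of `τ`
    -- because `π ∘ τ = 0`.
    refine ⟨Φ, hΦ, hsrc ▸ hxχ, _, hΦS, π.isClosed_ker,
      ⟨_, (σ.isTopCompl_range_ker_of_leftInverse π hπσ).symm⟩, ψ, hψ, hsrc ▸ hmap, ρ, τ, hρτ, hπτ,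
      fun y hyΦ => ?_⟩
    rw [hsrc] at hyΦ
    rw [(hy y hyΦ).1, hΦρ y hyΦ]
  constructor
  · refine isSplitSubmanifoldNotPure_of_isAdapted fun x hx => ?_
    obtain ⟨Φ, hΦ, hxΦ, Y, hY, hYc, hYs, -⟩ := key x hx
    exact ⟨Φ, hΦ, hxΦ, Y, hY, hYc, hYs⟩
  · refine restrictsToSubmersion_of_isAdapted hp fun x hx => ?_
    obtain ⟨Φ, hΦ, hxΦ, Y, hY, hYc, -, hψ⟩ := key x hx
    exact ⟨Φ, hΦ, hxΦ, Y, hY, hYc, hψ⟩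

/-- Around a point, a submersion and a `C^r`-map with the same value are described by a linear
projection and by a `C^r`-map with values in the same chart. -/
theorem IsSubmersion.exists_charts
    {E' : Type*} [AddCommGroup E'] [Module 𝕜 E'] [TopologicalSpace E'] [IsTopologicalAddGroup E']
    [ContinuousSMul 𝕜 E'] [PolynormableSpace 𝕜 E'] [T2Space E']
    {M' : Type*} [TopologicalSpace M'] [ChartedSpace E' M'] (hM' : IsCrManifold r E' M')
    {f : M → N} {g : M' → N} (hf : IsSubmersion r E F f) (hg : IsCrMap r E' F g) {x : M}
    {y : M'} (hxy : f x = g y) :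
    ∃ φ ∈ maxAtlas r E M, ∃ θ ∈ maxAtlas r E' M', x ∈ φ.source ∧ y ∈ θ.source ∧
      ∃ (π : E →L[𝕜] F) (σ : F →L[𝕜] E) (k : E' → F), (∀ z, π (σ z) = z) ∧ IsCr r θ.target k ∧
        ∀ a ∈ φ.source, ∀ b ∈ θ.source, f a = g b ↔ π (φ a) = k (θ b) := by
  obtain ⟨φ, hφ, ψ, hψ, hxφ, hxψ, hmap, π, σ, hπσ, hloc⟩ := hf.2 x
  have hO : IsOpen (g ⁻¹' ψ.source) := ψ.open_source.preimage hg.1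
  -- The chart is shrunk so that `g` takes values in the source of `ψ`. Then `ψ ∘ g ∘ θ.symm` is
  -- `C^r` on all of `θ.target`, and `f a = g b` can be tested after the injective map `ψ`.
  set θ := (chartAt E' y).restr (g ⁻¹' ψ.source) with hθ
  have hθm : θ ∈ maxAtlas r E' M' :=
    restr_mem_maxAtlas (atlas_subset_maxAtlas hM' (chart_mem_atlas E' y)) _
  have hθs : θ.source = (chartAt E' y).source ∩ g ⁻¹' ψ.source :=
    (chartAt E' y).restr_source' _ hO
  have hθg : ∀ b ∈ θ.source, g b ∈ ψ.source := fun b hb => by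
    rw [hθs] at hb
    exact hb.2
  refine ⟨φ, hφ, θ, hθm, hxφ, ?_, π, σ, ψ ∘ g ∘ θ.symm, fun z => ?_, ?_, fun a ha b hb => ?_⟩
  · rw [hθs]
    refine ⟨mem_chart_source E' y, ?_⟩
    rw [mem_preimage, ← hxy]
    exact hxψ
  · exact DFunLike.congr_fun hπσ z
  · have hsub : θ.target ⊆ θ.target ∩ θ.symm ⁻¹' (g ⁻¹' ψ.source) := fun v hv =>
      ⟨hv, hθg _ (θ.map_target hv)⟩
    exact (hg.2 θ hθm ψ hψ).mono θ.open_target hsub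
  · have h1 := hloc _ (φ.map_source ha)
    rw [φ.left_inv ha] at h1
    rw [← h1, Function.comp_apply, Function.comp_apply, θ.left_inv hb]
    exact (ψ.injOn.eq_iff (hmap ha) (hθg b hb)).symm

end Submanifolds

end LCManifold

/-! ### Fibre products. -/

theorem theoremB {𝕜 : Type} [RCLike 𝕜] (r : Regularity 𝕜)
    {E₁ : Type*} [AddCommGroup E₁] [Module 𝕜 E₁] [TopologicalSpace E₁] [IsTopologicalAddGroup E₁]
    [ContinuousSMul 𝕜 E₁] [PolynormableSpace 𝕜 E₁] [T2Space E₁]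
    {E₂ : Type*} [AddCommGroup E₂] [Module 𝕜 E₂] [TopologicalSpace E₂] [IsTopologicalAddGroup E₂]
    [ContinuousSMul 𝕜 E₂] [PolynormableSpace 𝕜 E₂] [T2Space E₂]
    {F : Type*} [AddCommGroup F] [Module 𝕜 F] [TopologicalSpace F] [IsTopologicalAddGroup F]
    [ContinuousSMul 𝕜 F] [PolynormableSpace 𝕜 F] [T2Space F]
    {M₁ : Type*} [TopologicalSpace M₁] [T2Space M₁] [ChartedSpace E₁ M₁]
    {M₂ : Type*} [TopologicalSpace M₂] [T2Space M₂] [ChartedSpace E₂ M₂]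
    {N : Type*} [TopologicalSpace N] [T2Space N] [ChartedSpace F N]
    (hM₁ : IsCrManifold r E₁ M₁) (hM₂ : IsCrManifold r E₂ M₂) (hN : IsCrManifold r F N)
    (f : M₁ → N) (g : M₂ → N) (hf : IsCrMap r E₁ F f) (hg : IsCrMap r E₂ F g) :
    (IsSubmersion r E₁ F f →
      IsSplitSubmanifoldNotPure r (E₁ × E₂) (fibreProduct f g) ∧
      RestrictsToSubmersion r (E₁ × E₂) E₂ (fibreProduct f g) (Prod.snd : M₁ × M₂ → M₂)) ∧
    (IsSubmersion r E₂ F g →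
      IsSplitSubmanifoldNotPure r (E₁ × E₂) (fibreProduct f g) ∧
      RestrictsToSubmersion r (E₁ × E₂) E₁ (fibreProduct f g) (Prod.fst : M₁ × M₂ → M₁)) := by
  constructor
  · intro hsub
    refine isSplitSubmanifold_and_restrictsToSubmersion (F' := F) continuous_snd ?_
    rintro ⟨x, y⟩ hxy
    obtain ⟨φ, hφ, θ, hθ, hxφ, hyθ, π, σ, k, hπσ, hk, heq⟩ := hsub.exists_charts hM₂ hg hxy
    -- In the product chart the equation is `π v = k w`. The section `v = σ z` lies in the first
    -- factor, where `snd` vanishes; the section `inr` of `snd` lies in the kernel of `π ∘ fst`.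
    refine ⟨φ.prod θ, prod_mem_maxAtlas hφ hθ, ⟨hxφ, hyθ⟩, θ, hθ, fun p hp => hp.2,
      π.comp (ContinuousLinearMap.fst 𝕜 E₁ E₂), (ContinuousLinearMap.inl 𝕜 E₁ E₂).comp σ,
      ContinuousLinearMap.snd 𝕜 E₁ E₂, ContinuousLinearMap.inr 𝕜 E₁ E₂, k, fun z => ?_,
      fun z => ?_, fun z => ?_, fun z => ?_, hk, fun p hp => ⟨rfl, heq p.1 hp.1 p.2 hp.2⟩⟩
    · simp [hπσ]
    · simp
    · simp
    · simp
  · intro hsub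
    refine isSplitSubmanifold_and_restrictsToSubmersion (F' := F) continuous_fst ?_
    rintro ⟨x, y⟩ hxy
    -- The roles are exchanged: `θ` is the chart of `M₂` that linearises the submersion `g`, and `φ`
    -- the chart of `M₁` in which `f` becomes `k`.
    obtain ⟨θ, hθ, φ, hφ, hyθ, hxφ, π, σ, k, hπσ, hk, heq⟩ :=
      hsub.exists_charts hM₁ hf (Eq.symm hxy)
    refine ⟨φ.prod θ, prod_mem_maxAtlas hφ hθ, ⟨hxφ, hyθ⟩, φ, hφ, fun p hp => hp.1,
      π.comp (ContinuousLinearMap.snd 𝕜 E₁ E₂), (ContinuousLinearMap.inr 𝕜 E₁ E₂).comp σ,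
      ContinuousLinearMap.fst 𝕜 E₁ E₂, ContinuousLinearMap.inl 𝕜 E₁ E₂, k, fun z => ?_,
      fun z => ?_, fun z => ?_, fun z => ?_, hk,
      fun p hp => ⟨rfl, eq_comm.trans (heq p.2 hp.2 p.1 hp.1)⟩⟩
    · simp [hπσ]
    · simp
    · simp
    · simp
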